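/- Let $F$ be a non-archimedean local field with ring of integers $\mathcal O$, uniformizer $\pi$ and residue field of cardinality $q$. Let $G=\mathrm{SL}_2(F)$, let $I\subset \mathrm{SL}_2(\mathcal O)$ be the Iwahori subgroup of matrices whose lower left entry lies in $\pi\mathcal O$, and let $\tilde W=\langle s_0,s_1\mid s_0^2=s_1^2=1\rangle$ be the affine Weyl group, with length $\ell$ and strong Bruhat order $\le$. Here $s_0,s_1$ are represented in $G$ by $\begin{pmatrix}0&-1\\1&0\end{pmatrix}$ and $\begin{pmatrix}0&-\pi^{-1}\\ \pi&0\end{pmatrix}$. Let $H$ be the Iwahori–Hecke algebra of $\tilde W$ over $\mathbb Z[q^{1/2},q^{-1/2}]$ (with $q^{1/2}$ a variable), with standard basis $T_w$ and involution $j(\sum a_wT_w)=\sum\overline{a_w}(-1)^{\ell(w)}q^{-\ell(w)}T_w$, where $\overline{q^{1/2}}=q^{-1/2}$. Let $C'_w=q^{-\ell(w)/2}\sum_{y\le w}T_y$ and $C_w=(-1)^{\ell(w)}j(C'_w)$ be the Kazhdan–Lusztig bases, and write $C_xC_y=\sum_z h_{x,y,z}C_z$. Let $J$ be Lusztig's asymptotic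 Hecke algebra, with basis $(t_w)_{w\in\tilde W}$, let $a$ be Lusztig's $a$-function, and let $$\phi\Big(\sum_x b_xC_x\Big)=\sum_{x,z}\ \sum_{d\in\{1,s_0,s_1\},\ a(d)=a(z)} b_x h_{x,d,z}\,t_z$$ be Lusztig's map. It is considered from the completion of $H$ consisting of the sums $\sum_x b_xC_x$ with $b_x\in\mathbb Z((q^{1/2}))$ and $b_x\to0$ as $\ell(x)\to\infty$, to the analogous completion of $J$. The involution $j$ extends to a map from the completion consisting of the sums $\sum_x b_xC'_x$ with $b_x\in\mathbb Z((q^{-1/2}))$ and $b_x\to 0$ to the former completion of $H$. Then there is exactly one element of this last completion, again denoted $t_1$, that $\phi\circ j$ maps to the basis element $t_1$ of $J$. Expanded in the $T_w$ it is the scalar multiple $$t_1=\frac{1-q^{-1}}{1+q^{-1}}\;g,\qquad g=\sum_{w\in\tilde W}(-1)^{\ell(w)}q^{-\ell(w)}T_w .$$ Now specialize $q$ to the cardinality of the residue field; the coefficients of $t_1$ in the $T_w$ converge. View $T_w$ as the characteristic function of $IwI$, acting on $I$-invariant functions on $F^2\setminus\{0\}$ by convolution, $(T_w\star f)(x)=\sum_{\gamma\in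 IwI/I}f(\gamma^{-1}x)$. For $m\in\mathbb Z$ let $\psi_m$ and $\varphi_m$ be the characteristic functions of the $I$-orbits $$\begin{pmatrix}\pi^m\mathcal O^\times\\ \pi^{m+1}\mathcal O\end{pmatrix},\qquad \begin{pmatrix}\pi^m\mathcal O\\ \pi^{m}\mathcal O^\times\end{pmatrix}$$ in $F^2\setminus\{0\}$. Then for every $m\in\mathbb Z$ the series defining $t_1\star\psi_m$ and $t_1\star\varphi_m$ (the sum over $w$ of the coefficient of $T_w$ in $t_1$ times $T_w\star\psi_m$, respectively $T_w\star\varphi_m$) converge absolutely at every point of $F^2\setminus\{0\}$, and $$t_1\star\psi_m=t_1\star\varphi_m=0 .$$ -/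

import Mathlib

open ValuativeRel
open scoped LaurentPolynomial LaurentSeries MatrixGroups

noncomputable section

namespace AffineSL2

/-! ## The affine Weyl group `⟨s₀, s₁ | s₀² = s₁² = 1⟩` of `SL₂` -/

/-- The affine Weyl group of `SL₂`, i.e. the infinite dihedral group. The rotation `r n` is the
translation `π^n`, and `sr n = s₀ π^n`. -/
abbrev W : Type := DihedralGroup 0

/-- The simple reflections: `s₀` generates the finite Weyl group and `s₁ = s₀ π` is the affine
reflection; one has `s₀ s₁ = π`. -/
def s (i : Fin 2) : W := if i = 0 then .sr 0 else .sr 1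

/-- The product of a word in the simple reflections. -/
def wordProd (l : List (Fin 2)) : W := (l.map s).prod

/-- The Coxeter length: the least number of letters of a word with product `w`. -/
def length (w : W) : ℕ := sInf {n | ∃ l : List (Fin 2), l.length = n ∧ wordProd l = w}

/-- The alternating word with `n` letters whose first letter is `i`. -/
def altWord : Fin 2 → ℕ → List (Fin 2)
  | _, 0 => []
  | i, n + 1 => i :: altWord (1 - i) n

/-- The (unique) reduced word of `w`. -/
def reducedWord : W → List (Fin 2)
  | .r n => let k : ℤ := n
    if 0 ≤ k then altWord 0 (2 * k.natAbs) else altWord 1 (2 * k.natAbs)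
  | .sr n => let k : ℤ := n
    if k ≤ 0 then altWord 0 (2 * k - 1).natAbs else altWord 1 (2 * k - 1).natAbs

theorem length_altWord (i : Fin 2) (n : ℕ) : (altWord i n).length = n := by
  induction n generalizing i with
  | zero => rfl
  | succ n ih => simp [altWord, ih]

theorem wordProd_cons (i : Fin 2) (l : List (Fin 2)) : wordProd (i :: l) = s i * wordProd l := by
  simp [wordProd]

theorem wordProd_altWord (n : ℕ) :
    wordProd (altWord 0 (2 * n)) = .r (n : ℤ) ∧ wordProd (altWord 1 (2 * n)) = .r (-n : ℤ) ∧
    wordProd (altWord 0 (2 * n + 1)) = .sr (-n : ℤ) ∧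
    wordProd (altWord 1 (2 * n + 1)) = .sr (n + 1 : ℤ) := by
  have key : ∀ m : ℕ, wordProd (altWord 0 (2 * m)) = .r (m : ℤ) →
      wordProd (altWord 1 (2 * m)) = .r (-m : ℤ) →
      wordProd (altWord 0 (2 * m + 1)) = .sr (-m : ℤ) ∧
      wordProd (altWord 1 (2 * m + 1)) = .sr (m + 1 : ℤ) := by
    intro m h0 h1
    refine ⟨?_, ?_⟩
    · rw [altWord, wordProd_cons, show (1 - 0 : Fin 2) = 1 from rfl, h1, s, if_pos rfl]
      exact congrArg (DihedralGroup.sr (n := 0)) (zero_add (-(m : ℤ)))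
    · rw [altWord, wordProd_cons, show (1 - 1 : Fin 2) = 0 from rfl, h0, s, if_neg (by decide)]
      exact congrArg (DihedralGroup.sr (n := 0)) (add_comm (1 : ℤ) (m : ℤ))
  have main : wordProd (altWord 0 (2 * n)) = .r (n : ℤ) ∧
      wordProd (altWord 1 (2 * n)) = .r (-n : ℤ) := by
    induction n with
    | zero => exact ⟨rfl, rfl⟩
    | succ n ih =>
      obtain ⟨h0, h1⟩ := key n ih.1 ih.2
      refine ⟨?_, ?_⟩
      · rw [show 2 * (n + 1) = (2 * n + 1) + 1 from rfl, altWord, wordProd_cons,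
          show (1 - 0 : Fin 2) = 1 from rfl, h1, s, if_pos rfl]
        exact congrArg (DihedralGroup.r (n := 0)) (by push_cast; ring : ((n : ℤ) + 1 - 0) = ((n + 1 : ℕ) : ℤ))
      · rw [show 2 * (n + 1) = (2 * n + 1) + 1 from rfl, altWord, wordProd_cons,
          show (1 - 1 : Fin 2) = 0 from rfl, h0, s, if_neg (by decide)]
        exact congrArg (DihedralGroup.r (n := 0)) (by push_cast; ring : (-(n : ℤ) - 1) = -((n + 1 : ℕ) : ℤ))
  exact ⟨main.1, main.2, key n main.1 main.2⟩

theorem wordProd_reducedWord (w : W) : wordProd (reducedWord w) = w := by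
  rcases w with n | n
  · change ℤ at n
    by_cases h : 0 ≤ n
    · obtain ⟨m, rfl⟩ := Int.eq_ofNat_of_zero_le h
      simpa [reducedWord, h] using (wordProd_altWord m).1
    · obtain ⟨m, rfl⟩ := Int.exists_eq_neg_ofNat (le_of_not_ge h)
      simp only [reducedWord, if_neg h, Int.natAbs_neg, Int.natAbs_natCast]
      exact (wordProd_altWord m).2.1
  · change ℤ at n
    by_cases h : n ≤ 0
    · obtain ⟨m, rfl⟩ := Int.exists_eq_neg_ofNat h
      simp only [reducedWord, if_pos h]
      rw [show (2 * (-(m : ℤ)) - 1).natAbs = 2 * m + 1 by omega]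
      exact (wordProd_altWord m).2.2.1
    · obtain ⟨m, rfl⟩ : ∃ m : ℕ, n = m + 1 := ⟨(n - 1).toNat, by omega⟩
      simp only [reducedWord, if_neg h]
      rw [show (2 * ((m : ℤ) + 1) - 1).natAbs = 2 * m + 1 by omega]
      exact (wordProd_altWord m).2.2.2

theorem length_reducedWord_le (l : List (Fin 2)) :
    (reducedWord (wordProd l)).length ≤ l.length := by
  have hr : ∀ n : ℤ, (reducedWord (.r n)).length = 2 * n.natAbs := by
    intro n
    by_cases h : 0 ≤ n <;> simp [reducedWord, h, length_altWord]
  have hsr : ∀ n : ℤ, (reducedWord (.sr n)).length = (2 * n - 1).natAbs := by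
    intro n
    by_cases h : n ≤ 0 <;> simp [reducedWord, h, length_altWord]
  induction l with
  | nil => exact (hr 0).le
  | cons i l ih =>
    rw [wordProd_cons, List.length_cons]
    generalize wordProd l = w at ih
    rcases w with n | n
    · change ℤ at n
      rw [hr n] at ih
      fin_cases i
      · have : s 0 * DihedralGroup.r n = DihedralGroup.sr (0 + n : ℤ) := rfl
        simp only [Fin.zero_eta, this, hsr]
        omega
      · have : s 1 * DihedralGroup.r n = DihedralGroup.sr (1 + n : ℤ) := rfl
        simp only [Fin.mk_one, this, hsr]
        omega
    · change ℤ at n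
      rw [hsr n] at ih
      fin_cases i
      · have : s 0 * DihedralGroup.sr n = DihedralGroup.r (n - 0 : ℤ) := rfl
        simp only [Fin.zero_eta, this, hr]
        omega
      · have : s 1 * DihedralGroup.sr n = DihedralGroup.r (n - 1 : ℤ) := rfl
        simp only [Fin.mk_one, this, hr]
        omega

theorem length_reducedWord (w : W) : (reducedWord w).length = length w := by
  apply le_antisymm
  · obtain ⟨l, hl, hw⟩ := Nat.sInf_mem
      (s := {n | ∃ l : List (Fin 2), l.length = n ∧ wordProd l = w})
      ⟨_, reducedWord w, rfl, wordProd_reducedWord w⟩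
    have := length_reducedWord_le l
    rw [hw, hl] at this
    exact this
  · exact Nat.sInf_le ⟨reducedWord w, rfl, wordProd_reducedWord w⟩

/-- The set of all `y ≤ w` in the strong Bruhat order: the products of the words obtained by
deleting letters from the reduced word of `w`. -/
def bruhatIic (w : W) : Finset W := ((reducedWord w).sublists.map wordProd).toFinset

theorem self_mem_bruhatIic (w : W) : w ∈ bruhatIic w := by
  simp only [bruhatIic, List.mem_toFinset, List.mem_map, List.mem_sublists]
  exact ⟨reducedWord w, List.Sublist.refl _, wordProd_reducedWord w⟩

theorem length_lt_of_mem_bruhatIic {y w : W} (h : y ∈ bruhatIic w) (hne : y ≠ w) :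
    length y < length w := by
  simp only [bruhatIic, List.mem_toFinset, List.mem_map, List.mem_sublists] at h
  obtain ⟨l, hl, rfl⟩ := h
  have h1 : length (wordProd l) ≤ l.length := Nat.sInf_le ⟨l, rfl, rfl⟩
  have h2 := hl.length_le
  rw [← length_reducedWord w]
  rcases h2.lt_or_eq with h3 | h3
  · omega
  · exact absurd (by rw [hl.eq_of_length h3, wordProd_reducedWord]) hne

/-! ## The Iwahori-Hecke algebra `H` over `𝒜 = ℤ[q^{1/2}, q^{-1/2}]` -/

/-- The ring `𝒜 = ℤ[v, v⁻¹]`, where `v = q^{1/2}` is the Laurent variable `T 1`. -/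
abbrev A : Type := ℤ[T;T⁻¹]

/-- The power `v^n` of `v = q^{1/2}`. -/
abbrev v (n : ℤ) : A := LaurentPolynomial.T n

/-- The Iwahori-Hecke algebra as an `𝒜`-module: free on the basis `T_w = Finsupp.single w 1`. -/
abbrev H : Type := W →₀ A

/-- The basis element `T_w`. -/
def T (w : W) : H := Finsupp.single w 1

/-- Left multiplication by `T_s` for `s = s i`: `T_s T_w = T_{sw}` if `ℓ(sw) > ℓ(w)`, and
`T_s T_w = (q - 1) T_w + q T_{sw}` otherwise. -/
def mulGen (i : Fin 2) : H →ₗ[A] H :=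
  Finsupp.linearCombination A fun w =>
    if length w < length (s i * w) then T (s i * w) else (v 2 - 1) • T w + v 2 • T (s i * w)

/-- Left multiplication by `T_w`, `T_w = T_{s_{i₁}} ⋯ T_{s_{iₙ}}` for the reduced word of `w`. -/
def mulT (w : W) : H →ₗ[A] H := ((reducedWord w).map mulGen).prod

/-- The multiplication of `H`. -/
def mul (x y : H) : H := x.sum fun w a => a • mulT w y

/-- The involution `j (∑ a_w T_w) = ∑ \bar{a_w} (-1)^{ℓ(w)} q^{-ℓ(w)} T_w`, where `v ↦ v⁻¹` under
the bar. -/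
def j (x : H) : H :=
  x.sum fun w a => (LaurentPolynomial.invert a * (-1) ^ length w * v (-2 * length w)) • T w

/-- The Kazhdan-Lusztig element `C'_w = q^{-ℓ(w)/2} ∑_{y ≤ w} T_y`; for the infinite dihedral group
the Kazhdan-Lusztig polynomials `P_{y,w}`, `y ≤ w`, are all equal to `1`. -/
def C' (w : W) : H := v (-length w) • ∑ y ∈ bruhatIic w, T y

/-- The Kazhdan-Lusztig element `C_w = (-1)^{ℓ(w)} j(C'_w)`. -/
def C (w : W) : H := (-1 : A) ^ length w • j (C' w)

theorem j_apply (x : H) (y : W) :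
    j x y = LaurentPolynomial.invert (x y) * (-1) ^ length y * v (-2 * length y) := by
  rw [j, Finsupp.sum, Finsupp.finsetSum_apply]
  rw [Finset.sum_eq_single y]
  · simp [T]
  · intro b _ hb
    simp [T, hb]
  · intro hy
    simp [Finsupp.notMem_support_iff.mp hy]

theorem C'_apply (w y : W) : C' w y = if y ∈ bruhatIic w then v (-length w) else 0 := by
  rw [C', Finsupp.smul_apply, Finsupp.finsetSum_apply]
  by_cases hy : y ∈ bruhatIic w
  · rw [Finset.sum_eq_single y]
    · simp [T, hy]
    · intro b _ hb
      simp [T, hb]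
    · exact fun hn => absurd hy hn
  · rw [Finset.sum_eq_zero]
    · simp [hy]
    · intro b hb
      have : b ≠ y := fun e => hy (e ▸ hb)
      simp [T, this]

theorem C_apply (w y : W) : C w y =
    if y ∈ bruhatIic w then
      (-1) ^ length w * ((-1) ^ length y * v (length w - 2 * length y)) else 0 := by
  rw [C, Finsupp.smul_apply, j_apply, C'_apply]
  split_ifs with hy
  · simp only [v]
    rw [LaurentPolynomial.invert_T, smul_eq_mul, neg_neg, sub_eq_add_neg,
      LaurentPolynomial.T_add, neg_mul]
    ring
  · simp

theorem C_apply_self (w : W) : C w w = v (-length w) := by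
  rw [C_apply, if_pos (self_mem_bruhatIic w), ← mul_assoc, ← mul_pow]
  simp only [mul_neg, mul_one, neg_neg, one_pow, one_mul]
  congr 1
  ring

theorem linearIndependent_C : LinearIndependent A C := by
  rw [linearIndependent_iff]
  intro c hc
  by_contra hne
  obtain ⟨w, hw, hmax⟩ := c.support.exists_max_image length (Finsupp.support_nonempty_iff.mpr hne)
  have h1 : Finsupp.linearCombination A C c w = c w * v (-length w) := by
    rw [Finsupp.linearCombination_apply, Finsupp.sum, Finsupp.finsetSum_apply,
      Finset.sum_eq_single w]
    · rw [Finsupp.smul_apply, C_apply_self, smul_eq_mul]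
    · intro x hx hxw
      rw [Finsupp.smul_apply, C_apply, if_neg, smul_zero]
      intro hmem
      have := length_lt_of_mem_bruhatIic hmem hxw.symm
      have := hmax x hx
      omega
    · intro hn
      simp [Finsupp.notMem_support_iff.mp hn]
  rw [hc, Finsupp.zero_apply] at h1
  have h2 : c w = c w * v (-length w) * v (length w) := by
    rw [mul_assoc, v, v, ← LaurentPolynomial.T_add, neg_add_cancel, LaurentPolynomial.T_zero,
      mul_one]
  rw [← h1, zero_mul] at h2
  exact (Finsupp.mem_support_iff.mp hw) h2

theorem span_C : ⊤ ≤ Submodule.span A (Set.range C) := by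
  have key : ∀ n : ℕ, ∀ w : W, length w = n → T w ∈ Submodule.span A (Set.range C) := by
    intro n
    induction n using Nat.strong_induction_on with
    | _ n ih =>
      intro w hw
      have h1 : v (length w) • C w - T w ∈ Submodule.span A (Set.range C) := by
        rw [← Finsupp.sum_single (v (length w) • C w - T w), Finsupp.sum]
        refine Submodule.sum_mem _ fun y hy => ?_
        rw [← mul_one ((v (length w) • C w - T w) y), ← smul_eq_mul, ← Finsupp.smul_single]
        refine Submodule.smul_mem _ _ ?_
        have hyw : y ≠ w := by
          rintro rfl
          refine (Finsupp.mem_support_iff.mp hy) ?_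
          rw [Finsupp.sub_apply, Finsupp.smul_apply, C_apply_self, smul_eq_mul, v, v,
            ← LaurentPolynomial.T_add, add_neg_cancel, LaurentPolynomial.T_zero, T,
            Finsupp.single_eq_same, sub_self]
        have hmem : y ∈ bruhatIic w := by
          by_contra hn
          refine (Finsupp.mem_support_iff.mp hy) ?_
          rw [Finsupp.sub_apply, Finsupp.smul_apply, C_apply, if_neg hn, T,
            Finsupp.single_eq_of_ne hyw, smul_zero, sub_zero]
        exact ih _ (hw ▸ length_lt_of_mem_bruhatIic hmem hyw) y rfl
      have h2 : v (length w) • C w ∈ Submodule.span A (Set.range C) :=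
        Submodule.smul_mem _ _ (Submodule.subset_span ⟨w, rfl⟩)
      simpa using Submodule.sub_mem _ h2 h1
  intro x _
  rw [← Finsupp.sum_single x, Finsupp.sum]
  refine Submodule.sum_mem _ fun y _ => ?_
  rw [← mul_one (x y), ← smul_eq_mul, ← Finsupp.smul_single]
  exact Submodule.smul_mem _ _ (key _ y rfl)

/-- The elements `C_w` form a basis of `H`. -/
def basisC : Module.Basis W A H := Module.Basis.mk linearIndependent_C span_C

/-- The structure constants `h_{x,y,z}`, given by `C_x C_y = ∑_z h_{x,y,z} C_z`. -/
def h (x y z : W) : A := basisC.repr (mul (C x) (C y)) z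

/-- Lusztig's `a`-function: `a(z)` is the least `n` such that `(-v)^n h_{x,y,z} ∈ ℤ[v]` for all
`x` and `y`. -/
def a (z : W) : ℕ :=
  sInf {n | ∀ x y : W, (-v 1) ^ n * h x y z ∈ Set.range (Polynomial.toLaurent (R := ℤ))}

/-- The distinguished involutions. -/
def distinguished : Finset W := {1, s 0, s 1}

/-! ## Completions, the asymptotic Hecke algebra and the map `φ ∘ j` -/

/-- `f : W → ℤ((X))` tends to `0`: for every `N` one has `f x ∈ X^N ℤ[[X]]` as soon as `ℓ(x)` is
large enough. -/
def IsNull (f : W → ℤ⸨X⸩) : Prop :=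
  ∀ N : ℕ, ∃ L : ℕ, ∀ x, L ≤ length x → ∀ n : ℤ, n < N → (f x).coeff n = 0

/-- The formal sum of the family `f` of Laurent series exists and is `S`. -/
def HasFormalSum (f : W → ℤ⸨X⸩) (S : ℤ⸨X⸩) : Prop :=
  ∃ F : HahnSeries.SummableFamily ℤ ℤ W, (∀ x, F x = f x) ∧ F.hsum = S

/-- The embedding `ℤ[v, v⁻¹] → ℤ((v))`. -/
def toSeries (p : A) : ℤ⸨X⸩ := HahnSeries.ofFinsupp p.coeff

/-- Elements of the completion of `H` with respect to positive powers of `v` are the sums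
`∑ b_x C_x` with `b_x ∈ ℤ((v))` tending to `0`; elements of the completed asymptotic algebra `𝒥`
are the sums `∑ c_z t_z` with `c_z ∈ ℤ((v))` tending to `0`. `IsPhi b c` says that Lusztig's map
`φ` sends the former to the latter, where
`φ (∑ b_x C_x) = ∑_{x, z, d ∈ 𝒟, a(d) = a(z)} b_x h_{x,d,z} t_z`. -/
def IsPhi (b c : W → ℤ⸨X⸩) : Prop :=
  IsNull b ∧ IsNull c ∧
    ∀ z, HasFormalSum (fun x => ∑ d ∈ distinguished with a d = a z, b x * toSeries (h x d z)) (c z)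

/-- Elements of the completion of `H` with respect to negative powers of `v` are the sums
`∑ b_x C'_x` with `b_x ∈ ℤ((v⁻¹))` tending to `0`. The map `j` sends such a sum to
`∑ (-1)^{ℓ(x)} \bar{b_x} C_x`; here the bar maps `ℤ((v⁻¹))` to `ℤ((v))` by `v⁻¹ ↦ v`, hence is the
identity when both rings are written as `ℤ((X))`, with `X = v⁻¹` in the former and `X = v` in the
latter. -/
def jCompletion (b : W → ℤ⸨X⸩) : W → ℤ⸨X⸩ := fun x => (-1) ^ length x * b x

/-- The basis element `t_y` of the asymptotic Hecke algebra `J`, as an element of `𝒥`. -/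
def asympBasis (y : W) : W → ℤ⸨X⸩ := Pi.single y 1

/-- `IsAsympElement y t` says that `∑_w t_w T_w`, with `t_w ∈ ℤ((v⁻¹))` and `X = v⁻¹`, is the
expansion of `(φ ∘ j)⁻¹ (t_y)`: there is an element `∑ b_x C'_x` of the completion of `H` with
respect to negative powers of `v` which `φ ∘ j` maps to `t_y`, and substituting
`C'_x = v^{-ℓ(x)} ∑_{w ≤ x} T_w` gives the coefficients `t_w`. -/
def IsAsympElement (y : W) (t : W → ℤ⸨X⸩) : Prop :=
  ∃ b : W → ℤ⸨X⸩, IsNull b ∧ IsPhi (jCompletion b) (asympBasis y) ∧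
    ∀ w, HasFormalSum
      (fun x => if w ∈ bruhatIic x then HahnSeries.single (length x : ℤ) 1 * b x else 0) (t w)

/-- The coefficients of `g = ∑_w (-1)^{ℓ(w)} q^{-ℓ(w)} T_w`, where `X = q^{-1/2}`. -/
def g (w : W) : ℤ⸨X⸩ := (-1) ^ length w * HahnSeries.single (2 * length w : ℤ) 1

/-! ## The group `SL₂(F)` and its action on the plane -/

section Plane

variable (F : Type*) [Field F] [ValuativeRel F]

/-- The Iwahori subgroup `I` of `SL₂(F)`: integral entries, and lower left entry in the maximal
ideal. -/
def iwahori : Subgroup SL(2, F) where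
  carrier := {g | (∀ i k, valuation F (g i k) ≤ 1) ∧ valuation F (g 1 0) < 1}
  one_mem' := by
    refine ⟨fun i k => ?_, by simp⟩
    fin_cases i <;> fin_cases k <;> simp
  mul_mem' := by
    rintro x y ⟨hx, hx'⟩ ⟨hy, hy'⟩
    refine ⟨fun i k => ?_, ?_⟩
    · rw [Matrix.SpecialLinearGroup.coe_mul, Matrix.mul_apply, Fin.sum_univ_two]
      refine (valuation F).map_add_le ?_ ?_ <;> rw [map_mul]
      · exact mul_le_one' (hx _ _) (hy _ _)
      · exact mul_le_one' (hx _ _) (hy _ _)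
    · rw [Matrix.SpecialLinearGroup.coe_mul, Matrix.mul_apply, Fin.sum_univ_two]
      refine (valuation F).map_add_lt ?_ ?_ <;> rw [map_mul]
      · exact mul_lt_one_of_nonneg_of_lt_one_left zero_le hx' (hy _ _)
      · exact mul_lt_one_of_nonneg_of_lt_one_right (hx _ _) zero_le hy'
  inv_mem' := by
    rintro x ⟨hx, hx'⟩
    rw [Set.mem_ofPred_eq, Matrix.SpecialLinearGroup.SL2_inv_expl x]
    refine ⟨fun i k => ?_, ?_⟩
    · fin_cases i <;> fin_cases k <;> simp [hx]
    · simpa using hx'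

/-- The punctured plane `F² ∖ {0} = G/N`. -/
abbrev Plane : Type _ := {x : Fin 2 → F // x ≠ 0}

variable {F}

theorem uniformizer_ne_zero {ϖ : 𝒪[F]} (hϖ : Irreducible ϖ) : (ϖ : F) ≠ 0 := by
  simpa using hϖ.ne_zero

/-- The action of `SL₂(F)` on the punctured plane. -/
def act (g : SL(2, F)) (x : Plane F) : Plane F :=
  ⟨(g : Matrix (Fin 2) (Fin 2) F).mulVec x.1, fun h0 => x.2 <| by
    have h1 := congrArg ((g⁻¹ : SL(2, F)) : Matrix (Fin 2) (Fin 2) F).mulVec h0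
    rwa [Matrix.mulVec_mulVec, ← Matrix.SpecialLinearGroup.coe_mul, inv_mul_cancel,
      Matrix.SpecialLinearGroup.coe_one, Matrix.one_mulVec, Matrix.mulVec_zero] at h1⟩

/-- A representative of `w` in the normaliser of the diagonal torus: `diag(ϖ^n, ϖ^{-n})` for the
translation `r n`, and `s₀ diag(ϖ^n, ϖ^{-n})` with `s₀ = (0, -1; 1, 0)` for `sr n`. -/
def weylRep (ϖ : F) (hϖ : ϖ ≠ 0) : W → SL(2, F)
  | .r n => let k : ℤ := n
    ⟨!![ϖ ^ k, 0; 0, ϖ ^ (-k)], by simp [Matrix.det_fin_two_of, zpow_ne_zero, hϖ]⟩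
  | .sr n => let k : ℤ := n
    ⟨!![0, -ϖ ^ (-k); ϖ ^ k, 0], by simp [Matrix.det_fin_two_of, zpow_ne_zero, hϖ]⟩

/-- The set of cosets `IwI / I ⊆ SL₂(F) / I`. -/
def cell (ϖ : F) (hϖ : ϖ ≠ 0) (w : W) : Set (SL(2, F) ⧸ iwahori F) :=
  {c | ∃ i ∈ iwahori F, c = QuotientGroup.mk (i * weylRep ϖ hϖ w)}

/-- The convolution `T_w ⋆ f` of the characteristic function `T_w` of `IwI` with an `I`-invariant
function `f` on the punctured plane, for the Haar measure of total mass `1` on `I`: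
`(T_w ⋆ f)(x) = ∑_{γ ∈ IwI/I} f(γ⁻¹ x)`. For `f` the characteristic function of an `I`-orbit `X`
this is the number of points in the fibre over `x` of `IwI ×_I X → G/N`. -/
def conv (ϖ : F) (hϖ : ϖ ≠ 0) (w : W) (f : Plane F → ℂ) (x : Plane F) : ℂ :=
  ∑ᶠ c ∈ cell ϖ hϖ w, f (act (Quotient.out c)⁻¹ x)

/-- The characteristic function `ψ_m` of the `I`-orbit `(ϖ^m 𝒪ˣ, ϖ^{m+1} 𝒪)`. -/
def psi (ϖ : F) (m : ℤ) : Plane F → ℂ :=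
  Set.indicator {x | valuation F (x.1 0) = valuation F ϖ ^ m ∧
    valuation F (x.1 1) ≤ valuation F ϖ ^ (m + 1)} 1

/-- The characteristic function `φ_m` of the `I`-orbit `(ϖ^m 𝒪, ϖ^m 𝒪ˣ)`. -/
def phi (ϖ : F) (m : ℤ) : Plane F → ℂ :=
  Set.indicator {x | valuation F (x.1 0) ≤ valuation F ϖ ^ m ∧
    valuation F (x.1 1) = valuation F ϖ ^ m} 1

/-- `τ ⋆ f = h` for `τ = ∑_w τ_w T_w`: at every point of the punctured plane the series
`∑_w τ_w (T_w ⋆ f)` converges (unconditionally) to `h`. -/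
def ActsTo (ϖ : F) (hϖ : ϖ ≠ 0) (τ : W → ℂ) (f h : Plane F → ℂ) : Prop :=
  ∀ x, HasSum (fun w => τ w * conv ϖ hϖ w f x) (h x)

end Plane

/-- `τ` is the value of the Laurent series `p ∈ ℤ((X))` at `X = q^{-1/2}`, where `q` is now a
number: the series converges to `τ`. -/
def Specializes (q : ℕ) (p : ℤ⸨X⸩) (τ : ℂ) : Prop :=
  HasSum (fun n : ℤ => ((p.coeff n : ℤ) : ℂ) * ((Real.sqrt q : ℝ) : ℂ) ^ (-n)) τ

end AffineSL2

end

noncomputable section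

namespace AffineSL2

/-! ## Combinatorics of the infinite dihedral group -/

/-! The statement has two independent halves: an algebraic one, which computes the preimage of
`t_1`, and an analytic one, which shows that `g` kills the characteristic functions of the orbits.

Algebra. In the infinite dihedral group each length `n > 0` has exactly two elements, one on each
ray `elt 0`, `elt 1`, and Bruhat order only compares lengths. Left multiplication by `C_s` either
rescales `C_w` by `-(v + v⁻¹)` or produces the two neighbours of `sw` on a ray (`mulC_D_self`,
`mulC_D_one_sub`). Hence `a(1) = 0`, `a(w) = 1` for `w ≠ 1`, and `C_x (C_{s₀} + C_{s₁})` is the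
three-term expression of `lam_D_add`. The equation `φ(∑ c_x C_x) = t_1` thus says that `c_1 = 1` and
that along each ray `c_m + c_{m+2} = (v + v⁻¹) c_{m+1}`. The solutions are combinations of `v^m` and
`v^{-m}`; tending to zero excludes the second, so `c_x = v^{ℓ(x)}` (`eq_single_of_recurrence`).
Undoing `j` and expanding `C'_x`, the coefficient of `T_w` is `∑_{x ≥ w} (-1)^{ℓ(x)} q^{-ℓ(x)}`.
Above `w` lie `w` itself and two elements of every larger length, so this is `(-1)^{ℓ(w)} q^{-ℓ(w)}
(1 + 2 ∑_{d>0} (-q)^{-d})`, which is the claimed multiple of `g` (`hasFormalSum_kappa_mul_g`).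

Analysis. Everything is `I`-invariant, so it is enough to evaluate at the representatives `(ϖ^k, 0)`
and `(0, ϖ^k)` (`exists_eq_act_point`, `conv_act`). The cosets in `IwI/I` are parametrized by
`𝒪/ϖ^{ℓ(w)}` through upper unipotents when `w` begins with `s₀`, through lower ones when it begins
with `s₁` (`conv_eq_ncard`), so each `T_w ⋆ f` counts residues with prescribed valuation. For each
of the four choices of orbit and representative, exactly one `w` off a certain ray contributes a
power of `q`, up to sign, while the ray contributes a geometric series of the opposite sign with the
same total (`hasSum_zero_of_ray`). Their sum is `0`, and the scalar factor, which converges at `X =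
q^{-1/2}`, does not matter. -/

/-- The element of length `n` whose reduced word has first letter `i`. -/
def elt (i : Fin 2) (n : ℕ) : W := wordProd (altWord i n)

theorem elt_zero (i : Fin 2) : elt i 0 = 1 := rfl

theorem elt_succ (i : Fin 2) (n : ℕ) : elt i (n + 1) = s i * elt (1 - i) n := by
  rw [elt, altWord, wordProd_cons, elt]

theorem elt_one (i : Fin 2) : elt i 1 = s i := by
  rw [elt_succ, elt_zero, mul_one]

theorem s_mul_self (i : Fin 2) : s i * s i = 1 := by
  fin_cases i <;> rfl

theorem s_mul_elt (i : Fin 2) (n : ℕ) : s i * elt (1 - i) n = elt i (n + 1) := (elt_succ i n).symm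

theorem s_mul_elt_succ (i : Fin 2) (n : ℕ) : s i * elt i (n + 1) = elt (1 - i) n := by
  rw [elt_succ, ← mul_assoc, s_mul_self, one_mul]

theorem elt_zero_even (n : ℕ) : elt 0 (2 * n) = .r (n : ℤ) := (wordProd_altWord n).1

theorem elt_one_even (n : ℕ) : elt 1 (2 * n) = .r (-n : ℤ) := (wordProd_altWord n).2.1

theorem elt_zero_odd (n : ℕ) : elt 0 (2 * n + 1) = .sr (-n : ℤ) := (wordProd_altWord n).2.2.1

theorem elt_one_odd (n : ℕ) : elt 1 (2 * n + 1) = .sr (n + 1 : ℤ) := (wordProd_altWord n).2.2.2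

theorem reducedWord_elt (i : Fin 2) (n : ℕ) : reducedWord (elt i n) = altWord i n := by
  obtain ⟨m, rfl | rfl⟩ := n.even_or_odd' <;> fin_cases i
  · simp [elt_zero_even, reducedWord]
  · rcases m with _ | m
    · rfl
    · simp only [Fin.mk_one, elt_one_even, reducedWord]
      rw [if_neg (by omega)]
      congr 1
  · simp only [Fin.zero_eta, elt_zero_odd, reducedWord]
    rw [if_pos (by omega)]
    congr 1
    omega
  · simp only [Fin.mk_one, elt_one_odd, reducedWord]
    rw [if_neg (by omega)]
    congr 1
    omega

theorem length_elt (i : Fin 2) (n : ℕ) : length (elt i n) = n := by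
  rw [← length_reducedWord, reducedWord_elt, length_altWord]

theorem elt_injective {i k : Fin 2} {n m : ℕ} :
    elt i n = elt k m ↔ n = m ∧ (n = 0 ∨ i = k) := by
  constructor
  · intro he
    obtain rfl : n = m := by rw [← length_elt i n, he, length_elt]
    refine ⟨rfl, ?_⟩
    have := congrArg reducedWord he
    rw [reducedWord_elt, reducedWord_elt] at this
    rcases n with _ | n
    · exact Or.inl rfl
    · exact Or.inr (List.cons.inj this).1
  · rintro ⟨rfl, rfl | rfl⟩ <;> rfl

theorem exists_eq_elt (w : W) : ∃ i n, w = elt i n := by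
  have hw := wordProd_reducedWord w
  rcases w with n | n
  all_goals
    simp only [reducedWord] at hw
    split_ifs at hw
    · exact ⟨_, _, hw.symm⟩
    · exact ⟨_, _, hw.symm⟩

theorem eq_or_eq_one_sub (i k : Fin 2) : k = i ∨ k = 1 - i := by
  revert i k; decide

theorem one_sub_ne (i : Fin 2) : 1 - i ≠ i := by
  revert i; decide

/-- The dichotomy `s_i w > w` versus `s_i w < w`; left multiplication by `s_i` exchanges `elt (1 -
i) n` and `elt i (n + 1)`. -/
theorem eq_elt_one_sub_or_eq_elt_succ (i : Fin 2) (w : W) :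
    (∃ n, w = elt (1 - i) n) ∨ ∃ n, w = elt i (n + 1) := by
  obtain ⟨k, n, rfl⟩ := exists_eq_elt w
  rcases eq_or_eq_one_sub i k with rfl | rfl
  · rcases n with _ | n
    · exact Or.inl ⟨0, rfl⟩
    · exact Or.inr ⟨n, rfl⟩
  · exact Or.inl ⟨n, rfl⟩

theorem altWord_sublist (i : Fin 2) {m n : ℕ} (hmn : m ≤ n) :
    (altWord i m).Sublist (altWord i n) := by
  induction n generalizing i m with
  | zero => rw [Nat.le_zero.mp hmn]
  | succ n ih =>
    rcases m with _ | m
    · exact List.nil_sublist _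
    · exact (ih (1 - i) (Nat.le_of_succ_le_succ hmn)).cons_cons i

/-- Any strictly shorter alternating word is a subword: it is an initial segment of the word of `elt
i n`, or of that word with its first letter removed. -/
theorem elt_mem_bruhatIic {i k : Fin 2} {n m : ℕ} :
    elt k m ∈ bruhatIic (elt i n) ↔ m < n ∨ (m = n ∧ (n = 0 ∨ i = k)) := by
  constructor
  · intro hm
    by_cases he : elt k m = elt i n
    · obtain ⟨h1, h2⟩ := elt_injective.mp he
      refine Or.inr ⟨h1, ?_⟩
      rcases h2 with h2 | h2
      · exact Or.inl (h1 ▸ h2)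
      · exact Or.inr h2.symm
    · have := length_lt_of_mem_bruhatIic hm he
      rw [length_elt, length_elt] at this
      exact Or.inl this
  · rintro (hlt | ⟨rfl, h0⟩)
    · simp only [bruhatIic, List.mem_toFinset, List.mem_map, List.mem_sublists, reducedWord_elt]
      refine ⟨altWord k m, ?_, rfl⟩
      rcases eq_or_eq_one_sub i k with rfl | rfl
      · exact altWord_sublist _ hlt.le
      · obtain ⟨n, rfl⟩ : ∃ n', n = n' + 1 := ⟨n - 1, by omega⟩
        exact (altWord_sublist _ (Nat.le_of_lt_succ hlt)).trans (List.sublist_cons_self _ _)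
    · rw [show elt k m = elt i m from elt_injective.mpr ⟨rfl, h0.imp_right Eq.symm⟩]
      exact self_mem_bruhatIic _

/-! ## Left multiplication in the Hecke algebra -/

theorem mulGen_T (i : Fin 2) (w : W) : mulGen i (T w) =
    if length w < length (s i * w) then T (s i * w)
    else (v 2 - 1) • T w + v 2 • T (s i * w) := by
  exact (Finsupp.linearCombination_single A _ _).trans (one_smul _ _)

theorem mulGen_T_elt (i : Fin 2) (n : ℕ) : mulGen i (T (elt (1 - i) n)) = T (elt i (n + 1)) := by
  rw [mulGen_T, s_mul_elt, if_pos]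
  rw [length_elt, length_elt]
  exact n.lt_succ_self

theorem mulGen_T_elt_succ (i : Fin 2) (n : ℕ) : mulGen i (T (elt i (n + 1))) =
    (v 2 - 1) • T (elt i (n + 1)) + v 2 • T (elt (1 - i) n) := by
  rw [mulGen_T, s_mul_elt_succ, if_neg]
  rw [length_elt, length_elt]
  omega

theorem linearMap_ext_T {M : Type*} [AddCommMonoid M] [Module A M] {f f' : H →ₗ[A] M}
    (hf : ∀ w, f (T w) = f' (T w)) : f = f' := by
  ext w
  exact hf w

theorem mulGen_mulGen (i : Fin 2) (x : H) :
    mulGen i (mulGen i x) = (v 2 - 1) • mulGen i x + v 2 • x := by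
  suffices hs : mulGen i ∘ₗ mulGen i = (v 2 - 1) • mulGen i + v 2 • LinearMap.id from
    LinearMap.congr_fun hs x
  refine linearMap_ext_T fun w => ?_
  simp only [LinearMap.comp_apply, LinearMap.add_apply, LinearMap.smul_apply, LinearMap.id_apply]
  rcases eq_elt_one_sub_or_eq_elt_succ i w with ⟨n, rfl⟩ | ⟨n, rfl⟩
  · rw [mulGen_T_elt, mulGen_T_elt_succ]
  · rw [mulGen_T_elt_succ, map_add, map_smul, map_smul, mulGen_T_elt, mulGen_T_elt_succ]

theorem T_apply_elt (i k : Fin 2) (n m : ℕ) :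
    T (elt i n) (elt k m) = if n = m ∧ (n = 0 ∨ i = k) then 1 else 0 := by
  rw [T, Finsupp.single_apply]
  simp only [elt_injective]

/-- `T_s` preserves the span of each pair `T_w, T_{sw}`; this is the transpose of the 2×2 matrix
form, convenient for comparing coefficients. -/
theorem mulGen_apply (i : Fin 2) (x : H) (m : ℕ) :
    mulGen i x (elt (1 - i) m) = v 2 * x (elt i (m + 1)) ∧
    mulGen i x (elt i (m + 1)) = x (elt (1 - i) m) + (v 2 - 1) * x (elt i (m + 1)) := by
  induction x using Finsupp.induction_linear with
  | zero => simp
  | add f g hf hg =>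
    simp only [map_add, Finsupp.add_apply, hf, hg]
    constructor <;> ring
  | single w c =>
    rw [← mul_one c, ← smul_eq_mul, ← Finsupp.smul_single]
    change (mulGen i (c • T w)) _ = _ * (c • T w) _ ∧
      (mulGen i (c • T w)) _ = (c • T w) _ + _ * (c • T w) _
    have h0 := one_sub_ne i
    rcases eq_elt_one_sub_or_eq_elt_succ i w with ⟨n, rfl⟩ | ⟨n, rfl⟩
    · rw [map_smul, mulGen_T_elt]
      simp only [Finsupp.smul_apply, T_apply_elt, smul_eq_mul, h0, h0.symm]
      simp +contextual [mul_comm]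
    · rw [map_smul, mulGen_T_elt_succ]
      simp only [Finsupp.smul_apply, Finsupp.add_apply, T_apply_elt, smul_eq_mul, h0, h0.symm]
      constructor
      · by_cases hm : n = m <;> simp [hm, mul_comm]
      · by_cases hm : n = m
        · simp [hm, mul_comm]
        · simp +contextual [hm]

/-- Left multiplication as an algebra-like map into the endomorphisms. -/
def lam : H →ₗ[A] Module.End A H := Finsupp.linearCombination A mulT

theorem mul_eq_lam (x y : H) : mul x y = lam x y := by
  rw [mul, lam, Finsupp.linearCombination_apply, Finsupp.sum, Finsupp.sum, LinearMap.sum_apply]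
  rfl

theorem lam_T (w : W) : lam (T w) = mulT w := by
  rw [lam, T, Finsupp.linearCombination_single, one_smul]

theorem mulT_elt_succ (i : Fin 2) (n : ℕ) :
    mulT (elt i (n + 1)) = mulGen i * mulT (elt (1 - i) n) := by
  rw [mulT, reducedWord_elt, mulT, reducedWord_elt, altWord, List.map_cons, List.prod_cons]

/-- Associativity when the left factor is a generator. On `T_w` with `s w > w` it is the definition
of `mulT`; with `s w < w` it is the quadratic relation. The full associativity of `mul` is never
needed. -/
theorem lam_mulGen (i : Fin 2) (x y : H) : lam (mulGen i x) y = mulGen i (lam x y) := by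
  suffices hs : (lam.flip y) ∘ₗ mulGen i = mulGen i ∘ₗ lam.flip y from LinearMap.congr_fun hs x
  refine linearMap_ext_T fun w => ?_
  simp only [LinearMap.comp_apply, LinearMap.flip_apply]
  rcases eq_elt_one_sub_or_eq_elt_succ i w with ⟨n, rfl⟩ | ⟨n, rfl⟩
  · rw [mulGen_T_elt, lam_T, mulT_elt_succ, lam_T]
    rfl
  · rw [mulGen_T_elt_succ, map_add, map_smul, map_smul, LinearMap.add_apply, LinearMap.smul_apply,
      LinearMap.smul_apply, lam_T, lam_T, mulT_elt_succ, Module.End.mul_apply, mulGen_mulGen]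

theorem mulT_one : mulT 1 = 1 := by
  rw [← elt_zero 0, mulT, reducedWord_elt]
  rfl

theorem mulT_T_one (w : W) : mulT w (T 1) = T w := by
  obtain ⟨i, n, rfl⟩ := exists_eq_elt w
  induction n generalizing i with
  | zero => rw [elt_zero, mulT_one]; rfl
  | succ n ih => rw [mulT_elt_succ, Module.End.mul_apply, ih, mulGen_T_elt]

theorem lam_T_one_right (x : H) : lam x (T 1) = x := by
  suffices hs : lam.flip (T 1) = LinearMap.id from LinearMap.congr_fun hs x
  refine linearMap_ext_T fun w => ?_
  rw [LinearMap.flip_apply, lam_T, mulT_T_one, LinearMap.id_apply]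

theorem C_elt_apply (i k : Fin 2) (n m : ℕ) : C (elt i n) (elt k m) =
    if m < n ∨ (m = n ∧ (n = 0 ∨ i = k)) then (-1) ^ n * ((-1) ^ m * v (n - 2 * m)) else 0 := by
  rw [C_apply, length_elt, length_elt]
  simp only [elt_mem_bruhatIic]

theorem H_ext {x y : H} (i : Fin 2) (h1 : ∀ m, x (elt (1 - i) m) = y (elt (1 - i) m))
    (h2 : ∀ m, x (elt i (m + 1)) = y (elt i (m + 1))) : x = y := by
  ext1 w
  rcases eq_elt_one_sub_or_eq_elt_succ i w with ⟨n, rfl⟩ | ⟨n, rfl⟩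
  · exact h1 n
  · exact h2 n

theorem C_one : C 1 = T 1 := by
  refine H_ext 0 (fun m => ?_) (fun m => ?_) <;>
  · rw [← elt_zero 0, C_elt_apply, T_apply_elt]
    rcases m with _ | m <;> simp

theorem lam_C_one (x : H) : lam (C 1) x = x := by
  rw [C_one, lam_T, mulT_one]
  rfl

/-! ### Left multiplication by `C_s` in the Kazhdan–Lusztig basis -/

/-- Left multiplication by `C_{s i} = v⁻¹ T_{s i} - v`. -/
def mulC (i : Fin 2) : H →ₗ[A] H := v (-1) • mulGen i - v 1 • LinearMap.id

theorem mulC_apply (i : Fin 2) (x : H) : mulC i x = v (-1) • mulGen i x - v 1 • x := rfl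

theorem lam_mulC (i : Fin 2) (x y : H) : lam (mulC i x) y = mulC i (lam x y) := by
  rw [mulC_apply, mulC_apply, map_sub, map_smul, map_smul, LinearMap.sub_apply,
    LinearMap.smul_apply, LinearMap.smul_apply, lam_mulGen]

theorem v_mul (k l : ℤ) : v k * v l = v (k + l) := (LaurentPolynomial.T_add k l).symm

theorem v_zero : v 0 = 1 := LaurentPolynomial.T_zero

/-- On each pair `{w, sw}` only the difference of the two coefficients survives, so `C_s x` is
determined by these differences. -/
theorem mulC_apply_elt (i : Fin 2) (x : H) (m : ℕ) :
    mulC i x (elt (1 - i) m) = v 1 * (x (elt i (m + 1)) - x (elt (1 - i) m)) ∧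
    mulC i x (elt i (m + 1)) = v (-1) * (x (elt (1 - i) m) - x (elt i (m + 1))) := by
  obtain ⟨h1, h2⟩ := mulGen_apply i x m
  have h3 : v (-1) * v 2 = v 1 := v_mul _ _
  rw [mulC_apply]
  simp only [Finsupp.sub_apply, Finsupp.smul_apply, smul_eq_mul, h1, h2]
  constructor
  · rw [← mul_assoc, h3, mul_sub]
  · rw [mul_add, sub_mul, mul_sub, ← mul_assoc, h3]
    ring

/-- `C_w` for the nontrivial element `w = elt i n`, and `0` if `n = 0`. -/
def D (i : Fin 2) : ℕ → H
  | 0 => 0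
  | n + 1 => C (elt i (n + 1))

theorem D_apply (i k : Fin 2) (n m : ℕ) : D i n (elt k m) =
    if m < n ∨ (m = n ∧ n ≠ 0 ∧ i = k) then (-1) ^ n * ((-1) ^ m * v (n - 2 * m)) else 0 := by
  rcases n with _ | n
  · simp [D]
  · rw [D, C_elt_apply]
    simp

theorem mulC_D_self (i : Fin 2) (n : ℕ) : mulC i (D i n) = -((v 1 + v (-1)) • D i n) := by
  refine H_ext i (fun m => ?_) (fun m => ?_)
  · rw [(mulC_apply_elt i _ m).1]
    simp only [Finsupp.neg_apply, Finsupp.smul_apply, smul_eq_mul, D_apply]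
    have e : v (-1) * v (n - 2 * m) = v 1 * v (n - 2 * (m + 1 : ℕ)) := by
      rw [v_mul, v_mul]; congr 1; push_cast; ring
    have h0 := (one_sub_ne i).symm
    have c1 : (m + 1 < n ∨ m + 1 = n ∧ n ≠ 0) ↔ m < n := by omega
    simp only [h0, and_false, or_false, and_true, c1]
    split_ifs with hm
    · linear_combination ((-1) ^ n * (-1) ^ m) * e
    · ring
  · rw [(mulC_apply_elt i _ m).2]
    simp only [Finsupp.neg_apply, Finsupp.smul_apply, smul_eq_mul, D_apply]
    have e : v (-1) * v (n - 2 * m) = v 1 * v (n - 2 * (m + 1 : ℕ)) := by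
      rw [v_mul, v_mul]; congr 1; push_cast; ring
    have h0 := (one_sub_ne i).symm
    have c1 : (m + 1 < n ∨ m + 1 = n ∧ n ≠ 0) ↔ m < n := by omega
    simp only [h0, and_false, or_false, and_true, c1]
    split_ifs with hm
    · linear_combination ((-1) ^ n * (-1) ^ m) * e
    · ring

/-- Here `s_i` lengthens the word. The convention `D i 0 = 0` matters at `n = 0`: `C_{s_i}
C_{s_{1-i}}` has no `C_1` term, and the formula needs no exceptional case. -/
theorem mulC_D_one_sub (i : Fin 2) (n : ℕ) :
    mulC i (D (1 - i) (n + 1)) = D i (n + 2) + D i n := by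
  have h0 := one_sub_ne i
  refine H_ext i (fun m => ?_) (fun m => ?_)
  · rw [(mulC_apply_elt i _ m).1]
    simp only [Finsupp.add_apply, D_apply, h0, h0.symm, and_false, or_false, and_true]
    have e1 : v 1 * v ((n + 1 : ℕ) - 2 * m) = v ((n + 2 : ℕ) - 2 * m) := by
      rw [v_mul]; congr 1; push_cast; ring
    have e2 : v 1 * v ((n + 1 : ℕ) - 2 * (m + 1 : ℕ)) = v (n - 2 * m) := by
      rw [v_mul]; congr 1; push_cast; ring
    have c1 : (m < n + 1 ∨ m = n + 1 ∧ n + 1 ≠ 0) ↔ m < n + 2 := by omega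
    have c2 : m + 1 < n + 1 ↔ m < n := by omega
    simp only [c1, c2, ← e1, ← e2]
    split_ifs
    · ring
    · omega
    · ring
    · ring
  · rw [(mulC_apply_elt i _ m).2]
    simp only [Finsupp.add_apply, D_apply, h0, and_false, or_false, and_true]
    have e1 : v (-1) * v ((n + 1 : ℕ) - 2 * m) = v ((n + 2 : ℕ) - 2 * (m + 1 : ℕ)) := by
      rw [v_mul]; congr 1; push_cast; ring
    have e2 : v (-1) * v ((n + 1 : ℕ) - 2 * (m + 1 : ℕ)) = v (n - 2 * (m + 1 : ℕ)) := by
      rw [v_mul]; congr 1; push_cast; ring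
    have c1 : (m < n + 1 ∨ m = n + 1 ∧ n + 1 ≠ 0) ↔ m < n + 2 := by omega
    have c2 : (m + 1 < n + 2 ∨ m + 1 = n + 2 ∧ n + 2 ≠ 0) ↔ m < n + 2 := by omega
    have c3 : (m + 1 < n ∨ m + 1 = n ∧ n ≠ 0) ↔ m < n := by omega
    have c4 : m + 1 < n + 1 ↔ m < n := by omega
    simp only [c1, c2, c3, c4, ← e1, ← e2]
    split_ifs
    · ring
    · ring
    · omega
    · ring

theorem mulC_C_one (i : Fin 2) : mulC i (C 1) = D i 1 := by
  refine H_ext i (fun m => ?_) (fun m => ?_)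
  · rw [(mulC_apply_elt i _ m).1, ← elt_zero i, C_elt_apply, C_elt_apply, D_apply]
    rcases m with _ | m <;> simp [(one_sub_ne i).symm]
  · rw [(mulC_apply_elt i _ m).2, ← elt_zero i, C_elt_apply, C_elt_apply, D_apply]
    rcases m with _ | m <;> simp

theorem lam_D_one (i : Fin 2) (x : H) : lam (D i 1) x = mulC i x := by
  rw [← mulC_C_one, lam_mulC, lam_C_one]

/-- Generates all `C_w` from the `C_s` by left multiplication, so that products with `C_w` can be
computed by a two-step induction on the length. -/
theorem lam_D_add_two (i : Fin 2) (n : ℕ) (x : H) :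
    lam (D i (n + 2)) x = mulC i (lam (D (1 - i) (n + 1)) x) - lam (D i n) x := by
  rw [← lam_mulC, mulC_D_one_sub, map_add, LinearMap.add_apply, add_sub_cancel_right]

/-! ## Structure constants and the `a`-function -/

theorem h_eq (x y z : W) : h x y z = basisC.repr (lam (C x) (C y)) z := by
  rw [h, mul_eq_lam]

theorem basisC_apply (w : W) : basisC w = C w := Module.Basis.mk_apply _ _ _

theorem repr_C (w z : W) : basisC.repr (C w) z = if w = z then 1 else 0 := by
  rw [← basisC_apply, Module.Basis.repr_self, Finsupp.single_apply]

theorem repr_D_elt (i k : Fin 2) (n m : ℕ) :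
    basisC.repr (D i n) (elt k (m + 1)) = if n = m + 1 ∧ i = k then 1 else 0 := by
  rcases n with _ | n
  · simp [D]
  · rw [D, repr_C]
    simp [elt_injective]

theorem repr_D_one (i : Fin 2) (n : ℕ) : basisC.repr (D i n) 1 = 0 := by
  rcases n with _ | n
  · simp [D]
  · rw [D, repr_C, if_neg]
    rw [← elt_zero i, elt_injective]
    omega

/-! ### Poles of the structure constants -/

/-- Sums of the `p C_w` with `v p ∈ ℤ[v]` and `w ≠ 1` a product of a reduced word with first
letter `i`. -/
def leftCell (i : Fin 2) : AddSubgroup H :=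
  AddSubgroup.closure {x | ∃ p n, v 1 * p ∈ Set.range (Polynomial.toLaurent (R := ℤ)) ∧
    x = p • D i n}

theorem v_mem_range (n : ℕ) : v n ∈ Set.range (Polynomial.toLaurent (R := ℤ)) :=
  ⟨_, Polynomial.toLaurent_X_pow n⟩

theorem smul_D_mem_leftCell {i : Fin 2} {n : ℕ} {p : A}
    (hp : v 1 * p ∈ Set.range (Polynomial.toLaurent (R := ℤ))) : p • D i n ∈ leftCell i :=
  AddSubgroup.subset_closure ⟨p, n, hp, rfl⟩

theorem D_mem_leftCell (i : Fin 2) (n : ℕ) : D i n ∈ leftCell i := by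
  rw [← one_smul A (D i n)]
  refine smul_D_mem_leftCell ?_
  rw [mul_one]
  exact v_mem_range 1

theorem mulC_mem_leftCell {i : Fin 2} {x : H} (hx : x ∈ leftCell (1 - i)) :
    mulC i x ∈ leftCell i := by
  induction hx using AddSubgroup.closure_induction with
  | mem x hx =>
    obtain ⟨p, n, hp, rfl⟩ := hx
    rw [map_smul]
    rcases n with _ | n
    · rw [D, map_zero, smul_zero]
      exact zero_mem _
    · rw [mulC_D_one_sub, smul_add]
      exact add_mem (smul_D_mem_leftCell hp) (smul_D_mem_leftCell hp)
  | zero => rw [map_zero]; exact zero_mem _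
  | add x y _ _ hx hy => rw [map_add]; exact add_mem hx hy
  | neg x _ hx => rw [map_neg]; exact neg_mem hx

theorem mulC_D_mem_leftCell (i k : Fin 2) (n : ℕ) : mulC i (D k n) ∈ leftCell i := by
  rcases eq_or_eq_one_sub i k with rfl | rfl
  · rw [mulC_D_self]
    refine neg_mem (smul_D_mem_leftCell ?_)
    rw [mul_add, v_mul, v_mul]
    exact ⟨Polynomial.X ^ 2 + 1, by simp [v]⟩
  · exact mulC_mem_leftCell (D_mem_leftCell _ _)

/-- The factor `v + v⁻¹` can occur only at the innermost multiplication by a `C_s`. Afterwards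
`C_{s_i}` always meets elements with first letter `1 - i`, which it moves to neighbours without a
new pole. Hence all coefficients have at most a simple pole, and `C_1` never appears. -/
theorem lam_D_mem_leftCell (i : Fin 2) (n : ℕ) (y : W) : lam (D i n) (C y) ∈ leftCell i := by
  induction n using Nat.twoStepInduction generalizing i with
  | zero => rw [D, map_zero]; exact zero_mem _
  | one =>
    obtain ⟨k, m, rfl⟩ := exists_eq_elt y
    rw [lam_D_one]
    rcases m with _ | m
    · rw [elt_zero, mulC_C_one]
      exact D_mem_leftCell _ _
    · exact mulC_D_mem_leftCell i k (m + 1)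
  | more n h0 h1 =>
    rw [lam_D_add_two]
    exact sub_mem (mulC_mem_leftCell (h1 _)) (h0 _)

theorem repr_mem_of_mem_leftCell {i : Fin 2} {x : H} (hx : x ∈ leftCell i) :
    basisC.repr x 1 = 0 ∧
      ∀ z, v 1 * basisC.repr x z ∈ (Polynomial.toLaurent (R := ℤ)).range := by
  induction hx using AddSubgroup.closure_induction with
  | mem x hx =>
    obtain ⟨p, n, hp, rfl⟩ := hx
    rw [map_smul]
    refine ⟨by rw [Finsupp.smul_apply, repr_D_one, smul_zero], fun z => ?_⟩
    obtain ⟨k, m, rfl⟩ := exists_eq_elt z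
    rw [Finsupp.smul_apply]
    rcases m with _ | m
    · rw [elt_zero, repr_D_one, smul_zero, mul_zero]
      exact zero_mem _
    · rw [repr_D_elt]
      split_ifs
      · rw [smul_eq_mul, mul_one]
        exact hp
      · rw [smul_zero, mul_zero]
        exact zero_mem _
  | zero => simp
  | add x y _ _ hx hy =>
    refine ⟨by rw [map_add, Finsupp.add_apply, hx.1, hy.1, add_zero], fun z => ?_⟩
    rw [map_add, Finsupp.add_apply, mul_add]
    exact add_mem (hx.2 z) (hy.2 z)
  | neg x _ hx =>
    refine ⟨by rw [map_neg, Finsupp.neg_apply, hx.1, neg_zero], fun z => ?_⟩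
    rw [map_neg, Finsupp.neg_apply, mul_neg]
    exact neg_mem (hx.2 z)

theorem h_elt_succ_mem (i : Fin 2) (n : ℕ) (y : W) : h (elt i (n + 1)) y 1 = 0 ∧
    ∀ z, v 1 * h (elt i (n + 1)) y z ∈ (Polynomial.toLaurent (R := ℤ)).range := by
  simp only [h_eq]
  exact repr_mem_of_mem_leftCell (lam_D_mem_leftCell i (n + 1) y)

theorem h_one_left (y z : W) : h 1 y z = if y = z then 1 else 0 := by
  rw [h_eq, lam_C_one, repr_C]

theorem h_one_right (x z : W) : h x 1 z = if x = z then 1 else 0 := by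
  rw [h_eq, C_one, lam_T_one_right, repr_C]

theorem a_one : a 1 = 0 := by
  refine Nat.le_zero.mp (Nat.sInf_le fun x y => ?_)
  rw [pow_zero, one_mul]
  change _ ∈ (Polynomial.toLaurent (R := ℤ)).range
  obtain ⟨i, n, rfl⟩ := exists_eq_elt x
  rcases n with _ | n
  · rw [elt_zero, h_one_left]
    split_ifs
    · exact one_mem _
    · exact zero_mem _
  · rw [(h_elt_succ_mem i n y).1]
    exact zero_mem _

theorem a_elt_succ (i : Fin 2) (n : ℕ) : a (elt i (n + 1)) = 1 := by
  have hmem : ∀ x y : W, (-v 1) ^ 1 * h x y (elt i (n + 1)) ∈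
      Set.range (Polynomial.toLaurent (R := ℤ)) := by
    intro x y
    change _ ∈ (Polynomial.toLaurent (R := ℤ)).range
    rw [pow_one, neg_mul]
    refine neg_mem ?_
    obtain ⟨k, m, rfl⟩ := exists_eq_elt x
    rcases m with _ | m
    · rw [elt_zero, h_one_left]
      split_ifs
      · rw [mul_one]
        exact v_mem_range 1
      · rw [mul_zero]
        exact zero_mem _
    · exact (h_elt_succ_mem k m y).2 _
  refine le_antisymm (Nat.sInf_le hmem) (Nat.one_le_iff_ne_zero.mpr fun h0 => ?_)
  rcases Nat.sInf_eq_zero.mp h0 with h1 | h1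
  -- The pole is attained: `h_{s_i, w, w} = -(v + v⁻¹)` for `w` with first letter `i`, and its
  -- coefficient at `v⁻¹` is nonzero.
  · obtain ⟨p, hp⟩ := h1 (elt i 1) (elt i (n + 1))
    rw [pow_zero, one_mul, h_eq] at hp
    change _ = basisC.repr (lam (D i 1) (D i (n + 1))) _ at hp
    rw [lam_D_one, mulC_D_self, map_neg, map_smul, Finsupp.neg_apply, Finsupp.smul_apply,
      repr_D_elt, if_pos ⟨rfl, rfl⟩, smul_eq_mul, mul_one] at hp
    have h2 := congrArg (fun f : A => f.coeff (-1)) hp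
    have h3 : (Polynomial.toLaurent p).coeff (-1) = 0 := by
      rw [← Finsupp.notMem_support_iff, LaurentPolynomial.support_coeff_toLaurent]
      simp
    rw [h3] at h2
    simp [v] at h2
  -- The infimum of the empty set is also `0`, so emptiness has to be excluded separately.
  · exact Set.eq_empty_iff_forall_notMem.mp h1 1 hmem

/-! ## The map `φ` in coordinates -/

/-- One of `s₀, s₁` is the last letter of `x` and yields `-(v + v⁻¹) C_x`; the other extends `x` on
the right and yields its two neighbours on the ray, without `C_1`. Since only left multiplication is
explicit, the proof inducts from the left. -/
theorem lam_D_add (i : Fin 2) (n : ℕ) : lam (D i (n + 1)) (D 0 1 + D 1 1) =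
    D i (n + 2) + D i n - (v 1 + v (-1)) • D i (n + 1) := by
  -- Makes the sum symmetric in the two reflections, so that the induction can exchange `i` and `1 -
  -- i`.
  have hsum : ∀ i : Fin 2, D 0 1 + D 1 1 = D i 1 + D (1 - i) 1 := by
    intro i
    fin_cases i
    · rfl
    · exact add_comm _ _
  induction n using Nat.twoStepInduction generalizing i with
  | zero =>
    rw [hsum i, lam_D_one, map_add, mulC_D_self, mulC_D_one_sub]
    abel
  | one =>
    have h1 : lam (D (1 - i) 1) (D 0 1 + D 1 1) =
        D (1 - i) 2 - (v 1 + v (-1)) • D (1 - i) 1 := by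
      rw [hsum (1 - i), lam_D_one, map_add, mulC_D_self, mulC_D_one_sub, D, D]
      abel
    rw [lam_D_add_two, h1, map_sub, map_smul, mulC_D_one_sub, mulC_D_one_sub]
    simp only [D, map_zero, LinearMap.zero_apply]
    module
  | more n h0 h1 =>
    rw [lam_D_add_two, h1, h0, map_sub, map_add, map_smul, mulC_D_one_sub, mulC_D_one_sub,
      mulC_D_one_sub]
    module

/-- The coefficients of `C_x (C_{s₀} + C_{s₁})`. -/
theorem h_s_add_h_s (x z : W) : h x (s 0) z + h x (s 1) z =
    basisC.repr (lam (C x) (D 0 1 + D 1 1)) z := by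
  rw [h_eq, h_eq, map_add, map_add, Finsupp.add_apply, ← elt_one, ← elt_one]
  rfl

theorem h_s_add_h_s_one (k : Fin 2) (m : ℕ) :
    h 1 (s 0) (elt k (m + 1)) + h 1 (s 1) (elt k (m + 1)) = if m = 0 then 1 else 0 := by
  rw [h_s_add_h_s, lam_C_one, map_add, Finsupp.add_apply, repr_D_elt, repr_D_elt]
  rcases m with _ | m
  · fin_cases k <;> simp
  · simp

theorem h_s_add_h_s_elt (i k : Fin 2) (n m : ℕ) :
    h (elt i (n + 1)) (s 0) (elt k (m + 1)) + h (elt i (n + 1)) (s 1) (elt k (m + 1)) =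
      if i = k then (if n + 1 = m then 1 else 0) + (if n = m + 1 then 1 else 0) -
        (if n = m then v 1 + v (-1) else 0) else 0 := by
  rw [h_s_add_h_s]
  change basisC.repr (lam (D i (n + 1)) _) _ = _
  rw [lam_D_add, map_sub, map_add, map_smul, Finsupp.sub_apply, Finsupp.add_apply,
    Finsupp.smul_apply, repr_D_elt, repr_D_elt, repr_D_elt]
  by_cases hi : i = k
  · simp [hi]
  · simp [hi]

theorem s_zero_ne_s_one : s 0 ≠ s 1 := by
  rw [← elt_one, ← elt_one, Ne, elt_injective]
  simp

theorem a_s (i : Fin 2) : a (s i) = 1 := by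
  rw [← elt_one, a_elt_succ]

theorem distinguished_filter_one : {d ∈ distinguished | a d = a 1} = {1} := by
  simp [distinguished, Finset.filter_insert, Finset.filter_singleton, a_s, a_one]

theorem distinguished_filter_elt_succ (k : Fin 2) (m : ℕ) :
    {d ∈ distinguished | a d = a (elt k (m + 1))} = {s 0, s 1} := by
  simp [distinguished, Finset.filter_insert, Finset.filter_singleton, a_s, a_one, a_elt_succ]

theorem toSeries_zero : toSeries 0 = 0 := by
  ext; simp [toSeries]

theorem toSeries_add (p p' : A) : toSeries (p + p') = toSeries p + toSeries p' := by
  ext; simp [toSeries]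

theorem toSeries_neg (p : A) : toSeries (-p) = -toSeries p := by
  ext; simp [toSeries]

theorem toSeries_v (n : ℤ) : toSeries (v n) = HahnSeries.single n 1 := by
  ext k
  simp only [toSeries, v, LaurentPolynomial.T, HahnSeries.coeff_ofFinsupp,
    HahnSeries.coeff_single]
  simp [eq_comm]

theorem toSeries_one : toSeries 1 = 1 := by
  rw [← v_zero, toSeries_v]
  rfl

theorem sum_phi_one (β : ℤ⸨X⸩) (x : W) :
    ∑ d ∈ distinguished with a d = a 1, β * toSeries (h x d 1) = if x = 1 then β else 0 := by
  rw [distinguished_filter_one, Finset.sum_singleton, h_one_right]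
  split_ifs
  · rw [toSeries_one, mul_one]
  · rw [toSeries_zero, mul_zero]

/-- The transpose of `lam_D_add`: `t_z` receives contributions only from `z` and its two neighbours
on the same ray. At `m = 0` the lower neighbour is `1`, which belongs to both rays and accounts for
`C_1 (C_{s₀} + C_{s₁})`. -/
theorem sum_phi_elt_succ (β : ℤ⸨X⸩) (x : W) (k : Fin 2) (m : ℕ) :
    ∑ d ∈ distinguished with a d = a (elt k (m + 1)),
      β * toSeries (h x d (elt k (m + 1))) =
    (if x = elt k m then β else 0) + (if x = elt k (m + 2) then β else 0) -
      (if x = elt k (m + 1) then β * (HahnSeries.single 1 1 + HahnSeries.single (-1) 1)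
        else 0) := by
  rw [distinguished_filter_elt_succ, Finset.sum_pair s_zero_ne_s_one, ← mul_add, ← toSeries_add]
  obtain ⟨i, n, rfl⟩ := exists_eq_elt x
  rcases n with _ | n
  · rw [elt_zero, h_s_add_h_s_one, ← elt_zero k]
    simp only [elt_injective]
    rcases m with _ | m
    · simp [toSeries_one]
    · simp [toSeries_zero]
  · rw [h_s_add_h_s_elt]
    simp only [elt_injective]
    by_cases hi : i = k
    · have c1 : n + 1 = m + 1 ↔ n = m := by omega
      have c2 : n + 1 = m + 2 ↔ n = m + 1 := by omega
      simp only [hi, or_true, and_true, if_true, c1, c2, sub_eq_add_neg, toSeries_add,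
        toSeries_neg, mul_add, mul_neg]
      congr 1
      · congr 1 <;> split_ifs <;> simp [toSeries_zero, toSeries_one]
      · split_ifs <;> simp [toSeries_zero, toSeries_add, toSeries_v, mul_add]
    · simp [hi, toSeries_zero]

/-! ## Formal sums -/

theorem HasFormalSum.unique {f : W → ℤ⸨X⸩} {S S' : ℤ⸨X⸩} (hS : HasFormalSum f S)
    (hS' : HasFormalSum f S') : S = S' := by
  obtain ⟨F, hF, rfl⟩ := hS
  obtain ⟨F', hF', rfl⟩ := hS'
  rw [show F = F' from HahnSeries.SummableFamily.ext fun x => (hF x).trans (hF' x).symm]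

theorem HasFormalSum.add {f f' : W → ℤ⸨X⸩} {S S' : ℤ⸨X⸩} (hS : HasFormalSum f S)
    (hS' : HasFormalSum f' S') : HasFormalSum (fun x => f x + f' x) (S + S') := by
  obtain ⟨F, hF, rfl⟩ := hS
  obtain ⟨F', hF', rfl⟩ := hS'
  exact ⟨F + F', fun x => by rw [HahnSeries.SummableFamily.add_apply, hF, hF'],
    HahnSeries.SummableFamily.hsum_add⟩

theorem HasFormalSum.sub {f f' : W → ℤ⸨X⸩} {S S' : ℤ⸨X⸩} (hS : HasFormalSum f S)
    (hS' : HasFormalSum f' S') : HasFormalSum (fun x => f x - f' x) (S - S') := by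
  obtain ⟨F, hF, rfl⟩ := hS
  obtain ⟨F', hF', rfl⟩ := hS'
  exact ⟨F - F', fun x => by rw [HahnSeries.SummableFamily.sub_apply, hF, hF'],
    HahnSeries.SummableFamily.hsum_sub⟩

theorem hasFormalSum_ite (y : W) (f : W → ℤ⸨X⸩) :
    HasFormalSum (fun x => if x = y then f x else 0) (f y) := by
  refine ⟨HahnSeries.SummableFamily.single y (f y), fun x => ?_,
    HahnSeries.SummableFamily.hsum_single _ _⟩
  rw [HahnSeries.SummableFamily.single_toFun, Pi.single_apply]
  change _ = if x = y then f x else 0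
  split_ifs with hx
  · rw [hx]
  · rfl

/-- Exponents bounded below by `0` and finitely many contributions to each coefficient are what a
summable family requires; the sum is then computed coefficientwise over the finite sets `t k`. -/
theorem hasFormalSum_of_coeff {f : W → ℤ⸨X⸩} {S : ℤ⸨X⸩}
    (hneg : ∀ x, ∀ k < 0, (f x).coeff k = 0) (t : ℤ → Finset W)
    (ht : ∀ x k, (f x).coeff k ≠ 0 → x ∈ t k)
    (hS : ∀ k, ∑ x ∈ t k, (f x).coeff k = S.coeff k) : HasFormalSum f S := by
  refine ⟨⟨f, Set.IsWF.isPWO (BddBelow.wellFoundedOn_lt ⟨0, ?_⟩), fun k =>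
    Set.Finite.subset (t k).finite_toSet fun x hx => ht x k hx⟩, fun x => rfl, ?_⟩
  · rintro k hk
    obtain ⟨x, hx⟩ := Set.mem_iUnion.mp hk
    by_contra hk0
    exact hx (hneg x k (not_le.mp hk0))
  · ext k
    rw [HahnSeries.SummableFamily.coeff_hsum, ← hS]
    exact finsum_eq_sum_of_support_subset _ fun x hx => ht x k hx

/-! ### The preimage of `t_1` under `φ` -/

/-- Every coefficient of the image is a sum of at most three terms, so the formal sums exist for any
`c` and the condition on the image becomes a linear recurrence on each ray with common initial value
`c 1 = 1`. -/
theorem isPhi_asympBasis_one_iff {c : W → ℤ⸨X⸩} : IsPhi c (asympBasis 1) ↔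
    IsNull c ∧ c 1 = 1 ∧ ∀ k m, c (elt k m) + c (elt k (m + 2)) -
      c (elt k (m + 1)) * (HahnSeries.single 1 1 + HahnSeries.single (-1) 1) = 0 := by
  have h1 : asympBasis 1 1 = 1 := Pi.single_eq_same _ _
  have hne : ∀ k m, elt k (m + 1) ≠ 1 := by
    intro k m
    rw [← elt_zero k, Ne, elt_injective]
    omega
  have h2 : ∀ k m, asympBasis 1 (elt k (m + 1)) = 0 := fun k m =>
    Pi.single_eq_of_ne (hne k m) _
  have hsum : ∀ k m, HasFormalSum
      (fun x => ∑ d ∈ distinguished with a d = a (elt k (m + 1)),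
        c x * toSeries (h x d (elt k (m + 1)))) (c (elt k m) + c (elt k (m + 2)) -
      c (elt k (m + 1)) * (HahnSeries.single 1 1 + HahnSeries.single (-1) 1)) := by
    intro k m
    simp only [sum_phi_elt_succ]
    exact ((hasFormalSum_ite _ c).add (hasFormalSum_ite _ c)).sub (hasFormalSum_ite _ fun x =>
      c x * (HahnSeries.single 1 1 + HahnSeries.single (-1) 1))
  have hsum1 : HasFormalSum
      (fun x => ∑ d ∈ distinguished with a d = a 1, c x * toSeries (h x d 1)) (c 1) := by
    simp only [sum_phi_one]
    exact hasFormalSum_ite _ c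
  constructor
  · rintro ⟨hc, -, hz⟩
    refine ⟨hc, ?_, fun k m => ?_⟩
    · rw [← h1]
      exact hsum1.unique (hz 1)
    · rw [← h2 k m]
      exact (hsum k m).unique (hz _)
  · rintro ⟨hc, hc1, hrec⟩
    refine ⟨hc, fun N => ⟨1, fun x hx n _ => ?_⟩, fun z => ?_⟩
    · obtain ⟨k, m, rfl⟩ := exists_eq_elt x
      rw [length_elt] at hx
      obtain ⟨m, rfl⟩ := Nat.exists_eq_add_of_le' hx
      rw [h2, HahnSeries.coeff_zero]
    · obtain ⟨k, m, rfl⟩ := exists_eq_elt z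
      rcases m with _ | m
      · rw [elt_zero, h1, ← hc1]
        exact hsum1
      · rw [h2, ← hrec k m]
        exact hsum k m

theorem single_mul_single_one (k l : ℤ) : (HahnSeries.single k 1 * HahnSeries.single l 1 : ℤ⸨X⸩) =
    HahnSeries.single (k + l) 1 := by
  rw [HahnSeries.single_mul_single, mul_one]

theorem single_zero_one : (HahnSeries.single 0 1 : ℤ⸨X⸩) = 1 := rfl

/-- The solution of the recurrence `β (m + 2) = (X + X⁻¹) β (m + 1) - β m` with `β 0 = 1` which
does not acquire poles is `β n = X ^ n`. -/
theorem eq_single_of_recurrence {β : ℕ → ℤ⸨X⸩} (h0 : β 0 = 1)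
    (hrec : ∀ m, β m + β (m + 2) -
      β (m + 1) * (HahnSeries.single 1 1 + HahnSeries.single (-1) 1) = 0)
    (hnull : ∃ L, ∀ n ≥ L, ∀ k : ℤ, k < 0 → (β n).coeff k = 0) (n : ℕ) :
    β n = HahnSeries.single (n : ℤ) 1 := by
  have hX : (HahnSeries.single 1 1 * HahnSeries.single (-1) 1 : ℤ⸨X⸩) = 1 := by
    rw [single_mul_single_one]; rfl
  obtain ⟨L, hL⟩ := hnull
  -- The operator `E - X` (with `E` the shift) removes the solution `X^n`, so `γ` is a multiple of
  -- the other one, `X^{-n}`.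
  set γ : ℕ → ℤ⸨X⸩ := fun n => β (n + 1) - HahnSeries.single 1 1 * β n with hγ
  have hγ1 : ∀ n, γ (n + 1) = HahnSeries.single (-1) 1 * γ n := by
    intro n
    simp only [hγ]
    linear_combination hrec n + β n * hX
  have hγ2 : ∀ n : ℕ, γ n = HahnSeries.single (-n : ℤ) 1 * γ 0 := by
    intro n
    induction n with
    | zero => rw [Nat.cast_zero, neg_zero, single_zero_one, one_mul]
    | succ n ih =>
      rw [hγ1, ih, ← mul_assoc, single_mul_single_one]
      rw [show (-1 + -(n : ℤ)) = -((n + 1 : ℕ) : ℤ) by push_cast; ring]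
  have hγ0 : γ 0 = 0 := by
    ext k
    -- The coefficient of `X^k` in `γ 0` reappears in `γ n` at exponent `k - n`. This `n` is past
    -- the threshold `L` and larger than `|k|`, so that exponent is negative and the coefficient
    -- vanishes.
    have h1 : (γ (L + k.natAbs + 1)).coeff (k + -((L + k.natAbs + 1 : ℕ) : ℤ)) = 0 := by
      simp only [hγ]
      rw [HahnSeries.coeff_sub, HahnSeries.coeff_single_mul, hL _ (by omega) _ (by omega),
        hL _ (by omega) _ (by omega), mul_zero, sub_zero]
    rw [hγ2, HahnSeries.coeff_single_mul_add, one_mul] at h1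
    rw [h1, HahnSeries.coeff_zero]
  induction n with
  | zero => rw [h0]; rfl
  | succ n ih =>
    have h1 := hγ2 n
    rw [hγ0, mul_zero, sub_eq_zero, ih, single_mul_single_one] at h1
    rw [h1, add_comm (1 : ℤ), Nat.cast_succ]

theorem isNull_single (u : W → ℤ) :
    IsNull fun x => HahnSeries.single (length x : ℤ) (u x) := by
  refine fun N => ⟨N, fun x hx n hn => ?_⟩
  rw [HahnSeries.coeff_single_of_ne]
  omega

theorem isPhi_asympBasis_one_iff_eq {c : W → ℤ⸨X⸩} : IsPhi c (asympBasis 1) ↔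
    c = fun x => HahnSeries.single (length x : ℤ) 1 := by
  rw [isPhi_asympBasis_one_iff]
  constructor
  · rintro ⟨hc, hc1, hrec⟩
    funext x
    obtain ⟨k, n, rfl⟩ := exists_eq_elt x
    rw [length_elt]
    refine eq_single_of_recurrence (β := fun n => c (elt k n)) hc1 (hrec k) ?_ n
    obtain ⟨L, hL⟩ := hc 0
    refine ⟨L, fun n hn j hj => hL _ ?_ j hj⟩
    rwa [length_elt]
  · rintro rfl
    refine ⟨isNull_single _, ?_, fun k m => ?_⟩
    · change HahnSeries.single (length (elt 0 0) : ℤ) 1 = 1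
      rw [length_elt]
      rfl
    · simp only [length_elt, mul_add, single_mul_single_one]
      rw [sub_eq_zero, add_comm, show ((m + 2 : ℕ) : ℤ) = ((m + 1 : ℕ) : ℤ) + 1 by push_cast; ring,
        show ((m + 1 : ℕ) : ℤ) + -1 = m by push_cast; ring]

theorem neg_one_pow_mul_single (n : ℕ) (k r : ℤ) :
    ((-1) ^ n * HahnSeries.single k r : ℤ⸨X⸩) = HahnSeries.single k ((-1) ^ n * r) := by
  rcases n.even_or_odd with hn | hn <;> simp [hn.neg_one_pow]

/-! ## The scalar factor -/

/-- The coefficients of `(1 - X²) / (1 + X²) = 1 + 2 ∑_{j > 0} (-1)^j X^{2j}`. -/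
def kappaCoeff (k : ℤ) : ℤ :=
  if k = 0 then 1 else if 0 < k ∧ 2 ∣ k then 2 * (-1) ^ (k / 2).natAbs else 0

theorem kappaCoeff_of_neg {k : ℤ} (hk : k < 0) : kappaCoeff k = 0 := by
  rw [kappaCoeff, if_neg hk.ne, if_neg fun h0 => hk.not_gt h0.1]

theorem kappaCoeff_two_mul_succ (j : ℕ) : kappaCoeff (2 * (j + 1 : ℕ)) = 2 * (-1) ^ (j + 1) := by
  rw [kappaCoeff, if_neg (by omega), if_pos (by omega)]
  congr 2
  omega

theorem kappaCoeff_of_odd {k : ℤ} (hk : ¬ 2 ∣ k) : kappaCoeff k = 0 := by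
  rw [kappaCoeff, if_neg (by rintro rfl; simp at hk), if_neg fun h0 => hk h0.2]

/-- The Laurent series `(1 - X²) / (1 + X²)`. -/
def kappa : ℤ⸨X⸩ :=
  HahnSeries.ofSuppBddBelow kappaCoeff
    ⟨0, fun _ hk => not_lt.mp fun h0 => hk (kappaCoeff_of_neg h0)⟩

theorem kappa_coeff (k : ℤ) : kappa.coeff k = kappaCoeff k := rfl

theorem kappa_mul : kappa * (1 + HahnSeries.single 2 1) = 1 - HahnSeries.single 2 1 := by
  ext k
  rw [mul_add, mul_one, HahnSeries.coeff_add, HahnSeries.coeff_sub, HahnSeries.coeff_mul_single,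
    kappa_coeff, kappa_coeff, mul_one, HahnSeries.coeff_one, HahnSeries.coeff_single]
  by_cases hk : 2 ∣ k
  · obtain ⟨j, rfl⟩ := hk
    rcases lt_or_ge j 0 with hj | hj
    · rw [kappaCoeff_of_neg (by omega), kappaCoeff_of_neg (by omega), if_neg (by omega),
        if_neg (by omega)]
      rfl
    · obtain ⟨j, rfl⟩ := Int.eq_ofNat_of_zero_le hj
      rcases j with _ | _ | j
      · simp [kappaCoeff]
      · simp [kappaCoeff]
      · rw [show (2 * ((j + 1 + 1 : ℕ) : ℤ) - 2) = 2 * ((j + 1 : ℕ) : ℤ) by push_cast; ring,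
          kappaCoeff_two_mul_succ, kappaCoeff_two_mul_succ, if_neg (by omega), if_neg (by omega)]
        ring
  · rw [kappaCoeff_of_odd hk, kappaCoeff_of_odd (by omega), if_neg (by omega), if_neg (by omega)]
    rfl

theorem kappa_mul_g (w : W) : kappa * g w =
    kappa * HahnSeries.single (2 * length w : ℤ) ((-1) ^ length w) := by
  rw [g, neg_one_pow_mul_single, mul_one]

theorem kappa_mul_g_coeff (w : W) (k : ℤ) :
    (kappa * g w).coeff k = kappaCoeff (k - 2 * length w) * (-1) ^ length w := by
  rw [kappa_mul_g, HahnSeries.coeff_mul_single, kappa_coeff]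

/-! ## The element `t_1` -/

/-- The coefficient of `X^{2j}` counts, with sign `(-1)^j`, the elements of length `j` above `w`:
none for `j < ℓ(w)`, only `w` for `j = ℓ(w)`, and two for `j > ℓ(w)`. These are the coefficients of
`κ` shifted by `2 ℓ(w)`. -/
theorem hasFormalSum_kappa_mul_g (w : W) : HasFormalSum (fun x => if w ∈ bruhatIic x then
    HahnSeries.single (length x : ℤ) 1 * HahnSeries.single (length x : ℤ) ((-1) ^ length x)
    else 0) (kappa * g w) := by
  obtain ⟨i, n, rfl⟩ := exists_eq_elt w
  have hc : ∀ (x : W) (k : ℤ), (if elt i n ∈ bruhatIic x then HahnSeries.single (length x : ℤ) 1 *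
      HahnSeries.single (length x : ℤ) ((-1) ^ length x) else 0 : ℤ⸨X⸩).coeff k =
      if elt i n ∈ bruhatIic x ∧ k = 2 * length x then (-1) ^ length x else 0 := by
    intro x k
    split_ifs with h1 h2 h2
    · rw [HahnSeries.single_mul_single, one_mul, h2.2, ← two_mul, HahnSeries.coeff_single_same]
    · rw [HahnSeries.single_mul_single, HahnSeries.coeff_single_of_ne]
      exact fun h3 => h2 ⟨h1, by rw [h3, two_mul]⟩
    · exact absurd h2.1 h1
    · exact HahnSeries.coeff_zero
  have hsupp : ∀ (x : W) (k : ℤ), (elt i n ∈ bruhatIic x ∧ k = 2 * length x) →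
      x ∈ ({elt 0 (k / 2).toNat, elt 1 (k / 2).toNat} : Finset W) := by
    rintro x k ⟨-, rfl⟩
    obtain ⟨j, m, rfl⟩ := exists_eq_elt x
    rw [length_elt, show ((2 * (m : ℤ)) / 2).toNat = m by omega]
    fin_cases j <;> simp
  refine hasFormalSum_of_coeff (fun x k hk => ?_)
    (fun k => {elt 0 (k / 2).toNat, elt 1 (k / 2).toNat})
    (fun x k hx => hsupp x k (ite_ne_right_iff.mp ((hc x k).symm.trans_ne hx)).1) fun k => ?_
  · rw [hc, if_neg]
    omega
  · simp only [hc]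
    rw [kappa_mul_g_coeff, length_elt]
    by_cases hk : ∃ j : ℕ, k = 2 * j
    · obtain ⟨j, rfl⟩ := hk
      rw [show ((2 * (j : ℤ)) / 2).toNat = j by omega]
      rcases j with _ | j
      -- In length `0` the two rays share the identity, so the pair collapses.
      · rw [elt_zero, elt_zero, Finset.pair_eq_singleton, Finset.sum_singleton, ← elt_zero i]
        simp only [elt_mem_bruhatIic, length_elt]
        rcases n with _ | n
        · simp [kappaCoeff]
        · rw [kappaCoeff_of_neg (by omega)]
          simp
      · rw [Finset.sum_pair (by simp [elt_injective])]
        simp only [elt_mem_bruhatIic, length_elt]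
        rcases lt_trichotomy n (j + 1) with hn | rfl | hn
        · obtain ⟨d, hd⟩ := Nat.exists_eq_add_of_lt hn
          rw [if_pos ⟨Or.inl hn, trivial⟩, if_pos ⟨Or.inl hn, trivial⟩,
            show (2 * ((j + 1 : ℕ) : ℤ) - 2 * n) = 2 * ((d + 1 : ℕ) : ℤ) by omega,
            kappaCoeff_two_mul_succ, hd]
          ring
        · fin_cases i <;> simp [kappaCoeff]
        · rw [kappaCoeff_of_neg (by omega), if_neg (by omega), if_neg (by omega)]
          ring
    · rw [Finset.sum_eq_zero fun x _ => if_neg fun h0 => hk ⟨_, h0.2⟩, kappaCoeff]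
      rw [if_neg fun h0 => hk ⟨n, by omega⟩, if_neg fun h0 => hk ⟨(k / 2).toNat, by omega⟩,
        zero_mul]

/-- Uniqueness is inherited from the recurrence: `c_x = X^{ℓ(x)}` forces `b_x = (-1)^{ℓ(x)}
X^{ℓ(x)}`, and formal sums have a unique value. -/
theorem isAsympElement_one_iff (t : W → ℤ⸨X⸩) :
    IsAsympElement 1 t ↔ t = fun w => kappa * g w := by
  have key : ∀ b : W → ℤ⸨X⸩, jCompletion b = (fun x => HahnSeries.single (length x : ℤ) 1) ↔
      b = fun x => HahnSeries.single (length x : ℤ) ((-1) ^ length x) := by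
    intro b
    constructor
    · intro hb
      funext x
      have h1 : (-1) ^ length x * b x = HahnSeries.single (length x : ℤ) 1 := congrFun hb x
      rw [← mul_one ((-1) ^ length x), ← neg_one_pow_mul_single, ← h1, ← mul_assoc, ← mul_pow]
      simp
    · rintro rfl
      funext x
      rw [jCompletion, neg_one_pow_mul_single, ← mul_pow]
      simp
  constructor
  · rintro ⟨b, -, hb, ht⟩
    rw [isPhi_asympBasis_one_iff_eq, key] at hb
    subst hb
    funext w
    exact (ht w).unique (hasFormalSum_kappa_mul_g w)
  · rintro rfl
    exact ⟨_, isNull_single _, isPhi_asympBasis_one_iff_eq.mpr ((key _).mpr rfl),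
      hasFormalSum_kappa_mul_g⟩

/-! ## Counting residues of given valuation -/

section Counting

variable {F : Type*} [Field F] [ValuativeRel F]

theorem valuation_integer_le_pow_iff (ϖ b : 𝒪[F]) (r : ℕ) :
    valuation F (b : F) ≤ valuation F (ϖ : F) ^ r ↔ ϖ ^ r ∣ b := by
  rw [(Valuation.integer.integers (valuation F)).dvd_iff_le, ← map_pow]
  rfl

theorem valuation_uniformizer_pos {ϖ : 𝒪[F]} (hϖ : Irreducible ϖ) :
    0 < valuation F (ϖ : F) :=
  zero_lt_iff.mpr ((valuation F).ne_zero_iff.mpr (uniformizer_ne_zero hϖ))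

theorem valuation_uniformizer_lt_one {ϖ : 𝒪[F]} (hϖ : Irreducible ϖ) :
    valuation F (ϖ : F) < 1 := by
  refine lt_of_le_of_ne ϖ.2 fun h1 => hϖ.not_isUnit ?_
  exact (Valuation.integer.integers (valuation F)).isUnit_of_one
    (isUnit_iff_ne_zero.mpr (uniformizer_ne_zero hϖ)) h1

theorem valuation_integer_eq_pow_iff {ϖ : 𝒪[F]} (hϖ : Irreducible ϖ)
    [IsDiscreteValuationRing 𝒪[F]] (b : 𝒪[F]) (r : ℕ) :
    valuation F (b : F) = valuation F (ϖ : F) ^ r ↔ ϖ ^ r ∣ b ∧ ¬ ϖ ^ (r + 1) ∣ b := by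
  rw [← valuation_integer_le_pow_iff, ← valuation_integer_le_pow_iff]
  constructor
  · intro he
    refine ⟨he.le, fun h1 => ?_⟩
    rw [he] at h1
    exact h1.not_gt (pow_lt_pow_right_of_lt_one₀ (valuation_uniformizer_pos hϖ)
      (valuation_uniformizer_lt_one hϖ) r.lt_succ_self)
  · rintro ⟨h1, h2⟩
    obtain ⟨c, rfl⟩ := (valuation_integer_le_pow_iff ϖ b r).mp h1
    rw [valuation_integer_le_pow_iff, pow_succ] at h2
    have hc : IsUnit c := by
      by_contra hc
      refine h2 (mul_dvd_mul_left _ ?_)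
      rwa [← Ideal.mem_span_singleton, ← hϖ.maximalIdeal_eq]
    have hc1 := (Valuation.integer.integers (valuation F)).one_of_isUnit hc
    have hc2 : valuation F (c : F) = 1 := hc1
    simp [hc2]

theorem valuation_integer_lt_pow_iff {ϖ : 𝒪[F]} (hϖ : Irreducible ϖ)
    [IsDiscreteValuationRing 𝒪[F]] (b : 𝒪[F]) (r : ℕ) :
    valuation F (b : F) < valuation F (ϖ : F) ^ r ↔ ϖ ^ (r + 1) ∣ b := by
  constructor
  · intro h1
    by_contra h2
    exact h1.ne ((valuation_integer_eq_pow_iff hϖ b r).mpr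
      ⟨(valuation_integer_le_pow_iff ϖ b r).mp h1.le, h2⟩)
  · intro h1
    exact ((valuation_integer_le_pow_iff ϖ b _).mpr h1).trans_lt
      (pow_lt_pow_right_of_lt_one₀ (valuation_uniformizer_pos hϖ)
        (valuation_uniformizer_lt_one hϖ) r.lt_succ_self)

/-- The residues modulo `ϖ^ℓ`. -/
abbrev Residues (ϖ : 𝒪[F]) (ℓ : ℕ) : Type _ := 𝒪[F] ⧸ Ideal.span {ϖ ^ ℓ}

/-- A representative of a residue. -/
def Residues.lift {ϖ : 𝒪[F]} {ℓ : ℕ} (c : Residues ϖ ℓ) : 𝒪[F] := Quotient.out c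

theorem Residues.mk_lift {ϖ : 𝒪[F]} {ℓ : ℕ} (c : Residues ϖ ℓ) :
    Ideal.Quotient.mk _ c.lift = c := Quotient.out_eq c

variable [TopologicalSpace F] [IsNonarchimedeanLocalField F]

theorem card_residues {ϖ : 𝒪[F]} (hϖ : Irreducible ϖ) (ℓ : ℕ) :
    Nat.card (Residues ϖ ℓ) = Nat.card 𝓀[F] ^ ℓ := by
  have hne : 𝓂[F] ≠ ⊥ := IsDiscreteValuationRing.not_a_field _
  rw [Residues, ← Ideal.span_singleton_pow, ← hϖ.maximalIdeal_eq, ← Submodule.cardQuot_apply,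
    cardQuot_pow_of_prime hne, Submodule.cardQuot_apply]
  rfl

theorem one_lt_card_residueField : 1 < Nat.card 𝓀[F] := Finite.one_lt_card

theorem finite_residues {ϖ : 𝒪[F]} (hϖ : Irreducible ϖ) (ℓ : ℕ) : Finite (Residues ϖ ℓ) := by
  refine Nat.finite_of_card_ne_zero ?_
  rw [card_residues hϖ]
  exact (pow_pos (zero_lt_one.trans one_lt_card_residueField) _).ne'

/-- The set is the kernel of `𝒪/ϖ^ℓ → 𝒪/ϖ^r`. Because `r ≤ ℓ`, divisibility by `ϖ^r` does not depend
on the chosen lift. -/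
theorem ncard_residues_dvd {ϖ : 𝒪[F]} (hϖ : Irreducible ϖ) {ℓ r : ℕ} (hr : r ≤ ℓ) :
    {c : Residues ϖ ℓ | ϖ ^ r ∣ c.lift}.ncard = Nat.card 𝓀[F] ^ (ℓ - r) := by
  have hle : Ideal.span {ϖ ^ ℓ} ≤ Ideal.span {ϖ ^ r} := by
    rw [Ideal.span_singleton_le_span_singleton]
    exact pow_dvd_pow _ hr
  let p : Residues ϖ ℓ →+ Residues ϖ r := (Ideal.Quotient.factor hle).toAddMonoidHom
  have hp : Function.Surjective p := Ideal.Quotient.factor_surjective hle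
  have hker : {c : Residues ϖ ℓ | ϖ ^ r ∣ c.lift} = (p.ker : Set (Residues ϖ ℓ)) := by
    ext c
    rw [Set.mem_ofPred_eq, SetLike.mem_coe, AddMonoidHom.mem_ker, ← Ideal.mem_span_singleton,
      ← Ideal.Quotient.eq_zero_iff_mem]
    nth_rewrite 2 [← c.mk_lift]
    rfl
  have hcard := AddSubgroup.card_eq_card_quotient_mul_card_addSubgroup p.ker
  rw [Nat.card_congr (QuotientAddGroup.quotientKerEquivOfSurjective p hp).toEquiv,
    card_residues hϖ, card_residues hϖ,
    show Nat.card 𝓀[F] ^ ℓ = Nat.card 𝓀[F] ^ r * Nat.card 𝓀[F] ^ (ℓ - r) by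
      rw [← pow_add, Nat.add_sub_cancel' hr]] at hcard
  rw [hker]
  exact (Nat.eq_of_mul_eq_mul_left
    (pow_pos (zero_lt_one.trans one_lt_card_residueField) _) hcard.symm)

theorem ncard_residues_le {ϖ : 𝒪[F]} (hϖ : Irreducible ϖ) {ℓ r : ℕ} (hr : r ≤ ℓ) :
    {c : Residues ϖ ℓ | valuation F (c.lift : F) ≤ valuation F (ϖ : F) ^ r}.ncard =
      Nat.card 𝓀[F] ^ (ℓ - r) := by
  simp only [valuation_integer_le_pow_iff]
  exact ncard_residues_dvd hϖ hr

theorem ncard_residues_eq {ϖ : 𝒪[F]} (hϖ : Irreducible ϖ) {ℓ r : ℕ} (hr : r < ℓ) :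
    {c : Residues ϖ ℓ | valuation F (c.lift : F) = valuation F (ϖ : F) ^ r}.ncard =
      (Nat.card 𝓀[F] - 1) * Nat.card 𝓀[F] ^ (ℓ - r - 1) := by
  have := finite_residues hϖ ℓ
  have hdiff : {c : Residues ϖ ℓ | valuation F (c.lift : F) = valuation F (ϖ : F) ^ r} =
      {c : Residues ϖ ℓ | ϖ ^ r ∣ c.lift} \ {c : Residues ϖ ℓ | ϖ ^ (r + 1) ∣ c.lift} := by
    ext c
    exact valuation_integer_eq_pow_iff hϖ _ _
  have hsub : {c : Residues ϖ ℓ | ϖ ^ (r + 1) ∣ c.lift} ⊆ {c : Residues ϖ ℓ | ϖ ^ r ∣ c.lift} :=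
    fun c hc => (pow_dvd_pow _ r.le_succ).trans hc
  rw [hdiff, Set.ncard_sdiff hsub (Set.toFinite _),
    ncard_residues_dvd hϖ hr.le, ncard_residues_dvd hϖ hr, Nat.sub_mul, one_mul, ← pow_succ']
  congr 2
  omega

end Counting

/-! ## Convolution on the punctured plane -/

section Convolution

variable {F : Type*} [Field F]

theorem act_apply_zero (g : SL(2, F)) (x : Plane F) :
    (act g x).1 0 = g 0 0 * x.1 0 + g 0 1 * x.1 1 := by
  simp [act]

theorem act_apply_one (g : SL(2, F)) (x : Plane F) :
    (act g x).1 1 = g 1 0 * x.1 0 + g 1 1 * x.1 1 := by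
  simp [act]

theorem plane_ext {x y : Plane F} (h0 : x.1 0 = y.1 0) (h1 : x.1 1 = y.1 1) : x = y := by
  apply Subtype.ext
  funext i
  fin_cases i
  · exact h0
  · exact h1

theorem inv_apply (g : SL(2, F)) : g⁻¹ 0 0 = g 1 1 ∧ g⁻¹ 0 1 = -g 0 1 ∧
    g⁻¹ 1 0 = -g 1 0 ∧ g⁻¹ 1 1 = g 0 0 := by
  rw [Matrix.SpecialLinearGroup.SL2_inv_expl g]
  exact ⟨rfl, rfl, rfl, rfl⟩

theorem act_inv_apply_zero (g : SL(2, F)) (x : Plane F) :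
    (act g⁻¹ x).1 0 = g 1 1 * x.1 0 - g 0 1 * x.1 1 := by
  rw [act_apply_zero, (inv_apply g).1, (inv_apply g).2.1]
  ring

theorem act_inv_apply_one (g : SL(2, F)) (x : Plane F) :
    (act g⁻¹ x).1 1 = -(g 1 0 * x.1 0) + g 0 0 * x.1 1 := by
  rw [act_apply_one, (inv_apply g).2.2.1, (inv_apply g).2.2.2]
  ring

theorem mul_entry (g g' : SL(2, F)) (i k : Fin 2) :
    (g * g') i k = g i 0 * g' 0 k + g i 1 * g' 1 k := by
  rw [Matrix.SpecialLinearGroup.coe_mul, Matrix.mul_apply, Fin.sum_univ_two]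

theorem SL2_ext {g g' : SL(2, F)} (h00 : g 0 0 = g' 0 0) (h01 : g 0 1 = g' 0 1)
    (h10 : g 1 0 = g' 1 0) (h11 : g 1 1 = g' 1 1) : g = g' := by
  apply Matrix.SpecialLinearGroup.ext
  intro i k
  fin_cases i <;> fin_cases k
  · exact h00
  · exact h01
  · exact h10
  · exact h11

theorem det_eq_one (g : SL(2, F)) : g 0 0 * g 1 1 - g 0 1 * g 1 0 = 1 := by
  rw [← Matrix.det_fin_two, g.2]

theorem weylRep_r_entry {ϖ : F} (hϖ : ϖ ≠ 0) (n : ℤ) : weylRep ϖ hϖ (.r n) 0 0 = ϖ ^ n ∧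
    weylRep ϖ hϖ (.r n) 0 1 = 0 ∧ weylRep ϖ hϖ (.r n) 1 0 = 0 ∧
    weylRep ϖ hϖ (.r n) 1 1 = ϖ ^ (-n) := ⟨rfl, rfl, rfl, rfl⟩

theorem weylRep_sr_entry {ϖ : F} (hϖ : ϖ ≠ 0) (n : ℤ) : weylRep ϖ hϖ (.sr n) 0 0 = 0 ∧
    weylRep ϖ hϖ (.sr n) 0 1 = -ϖ ^ (-n) ∧ weylRep ϖ hϖ (.sr n) 1 0 = ϖ ^ n ∧
    weylRep ϖ hϖ (.sr n) 1 1 = 0 := ⟨rfl, rfl, rfl, rfl⟩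

theorem act_mul (g g' : SL(2, F)) (x : Plane F) : act (g * g') x = act g (act g' x) := by
  apply plane_ext
  · simp only [act_apply_zero, act_apply_one, mul_entry]
    ring
  · simp only [act_apply_zero, act_apply_one, mul_entry]
    ring

theorem act_one (x : Plane F) : act 1 x = x := by
  apply plane_ext
  · rw [act_apply_zero]; simp
  · rw [act_apply_one]; simp

variable [ValuativeRel F]

/-- Invariance of a subset of the punctured plane under the Iwahori subgroup. -/
def IsIwahoriInvariant (S : Set (Plane F)) : Prop :=
  ∀ i ∈ iwahori F, ∀ x ∈ S, act i x ∈ S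

theorem IsIwahoriInvariant.act_mem_iff {S : Set (Plane F)} (hS : IsIwahoriInvariant S)
    {i : SL(2, F)} (hi : i ∈ iwahori F) {x : Plane F} : act i x ∈ S ↔ x ∈ S := by
  refine ⟨fun hx => ?_, hS i hi x⟩
  have h1 := hS _ (inv_mem hi) _ hx
  rwa [← act_mul, inv_mul_cancel, act_one] at h1

theorem IsIwahoriInvariant.indicator_act {S : Set (Plane F)} (hS : IsIwahoriInvariant S)
    {i : SL(2, F)} (hi : i ∈ iwahori F) (x : Plane F) :
    S.indicator (1 : Plane F → ℂ) (act i x) = S.indicator 1 x := by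
  classical
  simp only [Set.indicator_apply, hS.act_mem_iff hi]
  rfl

/-- Frees the convolution from the choice of coset representatives made in `conv`. -/
theorem IsIwahoriInvariant.indicator_act_out {S : Set (Plane F)} (hS : IsIwahoriInvariant S)
    (g : SL(2, F)) (x : Plane F) :
    S.indicator (1 : Plane F → ℂ) (act (Quotient.out (g : SL(2, F) ⧸ iwahori F))⁻¹ x) =
      S.indicator 1 (act g⁻¹ x) := by
  obtain ⟨i, hi⟩ := QuotientGroup.mk_out_eq_mul (iwahori F) g
  rw [hi, mul_inv_rev, act_mul, hS.indicator_act (inv_mem i.2)]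

/-- Left translation by `i⁻¹` permutes the cosets in `IwI/I`, so `T_w ⋆ f` is again `I`-invariant.
-/
theorem conv_act {ϖ : F} {hϖ : ϖ ≠ 0} {S : Set (Plane F)} (hS : IsIwahoriInvariant S)
    (w : W) {i : SL(2, F)} (hi : i ∈ iwahori F) (x : Plane F) :
    conv ϖ hϖ w (S.indicator 1) (act i x) = conv ϖ hϖ w (S.indicator 1) x := by
  refine finsum_mem_eq_of_bijOn (fun c => i⁻¹ • c) ⟨?_, ?_, ?_⟩ ?_
  · rintro c ⟨i', hi', rfl⟩
    exact ⟨i⁻¹ * i', mul_mem (inv_mem hi) hi', by rw [mul_assoc]; rfl⟩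
  · exact (MulAction.injective _).injOn
  · rintro c ⟨i', hi', rfl⟩
    refine ⟨_, ⟨i * i', mul_mem hi hi', rfl⟩, ?_⟩
    change QuotientGroup.mk (i⁻¹ * (i * i' * _)) = _
    rw [mul_assoc, inv_mul_cancel_left]
  · intro c _
    obtain ⟨g, rfl⟩ := QuotientGroup.mk_surjective c
    change _ = S.indicator 1 (act (Quotient.out (QuotientGroup.mk (i⁻¹ * g)))⁻¹ x)
    rw [hS.indicator_act_out, hS.indicator_act_out, mul_inv_rev, inv_inv, act_mul]

/-- If `IwI / I` is parametrized by the residues modulo `ϖ^ℓ` through a one-parameter subgroup,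
the convolution counts residues. -/
theorem conv_eq_ncard {ϖ : 𝒪[F]} (hϖ : (ϖ : F) ≠ 0) {S : Set (Plane F)}
    (hS : IsIwahoriInvariant S) {w : W} {ℓ : ℕ} [Finite (Residues ϖ ℓ)] {U : 𝒪[F] → SL(2, F)}
    (hU : ∀ b c, U (b + c) = U b * U c) (hUI : ∀ b, U b ∈ iwahori F)
    (hconj : ∀ b, (weylRep (ϖ : F) hϖ w)⁻¹ * U b * weylRep (ϖ : F) hϖ w ∈ iwahori F ↔ ϖ ^ ℓ ∣ b)
    (hdec : ∀ i ∈ iwahori F, ∃ b,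
      (weylRep (ϖ : F) hϖ w)⁻¹ * (U (-b) * i) * weylRep (ϖ : F) hϖ w ∈ iwahori F)
    (x : Plane F) : conv (ϖ : F) hϖ w (S.indicator 1) x =
      {c : Residues ϖ ℓ | act (U c.lift * weylRep (ϖ : F) hϖ w)⁻¹ x ∈ S}.ncard := by
  set n := weylRep (ϖ : F) hϖ w with hn
  have hU0 : U 0 = 1 := by
    have h1 := hU 0 0
    rwa [add_zero, left_eq_mul] at h1
  have hUneg : ∀ b, U (-b) = (U b)⁻¹ := by
    intro b
    rw [eq_inv_iff_mul_eq_one, ← hU, neg_add_cancel, hU0]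
  -- The cosets of `U b n` and `U c n` agree iff `n⁻¹ U(c - b) n` lies in `I`, which by `hconj` is
  -- congruence modulo `ϖ^ℓ`.
  have heq : ∀ b c, (QuotientGroup.mk (U b * n) : SL(2, F) ⧸ iwahori F) =
      QuotientGroup.mk (U c * n) ↔ ϖ ^ ℓ ∣ c - b := by
    intro b c
    rw [QuotientGroup.eq, ← hconj, show c - b = -b + c by ring, hU, hUneg]
    simp only [mul_inv_rev, mul_assoc]
  have hmk : ∀ b c : 𝒪[F], ϖ ^ ℓ ∣ c - b ↔
      Ideal.Quotient.mk (Ideal.span {ϖ ^ ℓ}) b = Ideal.Quotient.mk _ c := by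
    intro b c
    rw [eq_comm, Ideal.Quotient.eq, Ideal.mem_span_singleton]
  have hinj : Function.Injective
      (fun c : Residues ϖ ℓ => (QuotientGroup.mk (U c.lift * n) : SL(2, F) ⧸ iwahori F)) := by
    intro c c' hc
    rwa [heq, hmk, Residues.mk_lift, Residues.mk_lift] at hc
  -- Each coset is reached: by `hdec`, `i` is `U b` times a factor which conjugation by `n⁻¹` keeps
  -- in `I`.
  have hrange : cell (ϖ : F) hϖ w = Set.range
      (fun c : Residues ϖ ℓ => (QuotientGroup.mk (U c.lift * n) : SL(2, F) ⧸ iwahori F)) := by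
    ext c
    constructor
    · rintro ⟨i, hi, rfl⟩
      obtain ⟨b, hb⟩ := hdec i hi
      refine ⟨Ideal.Quotient.mk _ b, ?_⟩
      have h1 : (QuotientGroup.mk (U b * n) : SL(2, F) ⧸ iwahori F) = QuotientGroup.mk (i * n) := by
        rw [QuotientGroup.eq]
        rw [hUneg] at hb
        simpa only [mul_inv_rev, mul_assoc] using hb
      rw [← hn, ← h1, heq, hmk, Residues.mk_lift]
    · rintro ⟨b, rfl⟩
      exact ⟨_, hUI _, rfl⟩
  rw [conv, hrange, finsum_mem_range hinj]
  simp only [hS.indicator_act_out]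
  classical
  have := Fintype.ofFinite (Residues ϖ ℓ)
  rw [finsum_eq_sum_of_fintype, Set.ncard_eq_toFinset_card']
  simp only [Set.indicator_apply, Pi.one_apply, Finset.sum_boole, Set.toFinset_ofPred]

/-! ### Unipotent subgroups and factorization in the Iwahori subgroup -/

/-- The upper triangular one-parameter subgroup of the Iwahori subgroup. -/
def upper (b : 𝒪[F]) : SL(2, F) := ⟨!![1, (b : F); 0, 1], by simp [Matrix.det_fin_two_of]⟩

/-- The lower triangular one-parameter subgroup of the Iwahori subgroup. -/
def lower (ϖ b : 𝒪[F]) : SL(2, F) := ⟨!![1, 0; (ϖ * b : F), 1], by simp [Matrix.det_fin_two_of]⟩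

theorem mem_iwahori {g : SL(2, F)} : g ∈ iwahori F ↔
    (∀ i k, valuation F (g i k) ≤ 1) ∧ valuation F (g 1 0) < 1 := Iff.rfl

theorem mem_iwahori_iff {g : SL(2, F)} : g ∈ iwahori F ↔ valuation F (g 0 0) ≤ 1 ∧
    valuation F (g 0 1) ≤ 1 ∧ valuation F (g 1 0) < 1 ∧ valuation F (g 1 1) ≤ 1 := by
  rw [mem_iwahori]
  constructor
  · rintro ⟨h1, h2⟩
    exact ⟨h1 _ _, h1 _ _, h2, h1 _ _⟩
  · rintro ⟨h1, h2, h3, h4⟩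
    refine ⟨fun i k => ?_, h3⟩
    fin_cases i <;> fin_cases k
    · exact h1
    · exact h2
    · exact h3.le
    · exact h4

theorem upper_entry (b : 𝒪[F]) : upper b 0 0 = 1 ∧ upper b 0 1 = b ∧ upper b 1 0 = 0 ∧
    upper b 1 1 = 1 := ⟨rfl, rfl, rfl, rfl⟩

theorem lower_entry (ϖ b : 𝒪[F]) : lower ϖ b 0 0 = 1 ∧ lower ϖ b 0 1 = 0 ∧
    lower ϖ b 1 0 = ϖ * b ∧ lower ϖ b 1 1 = 1 := ⟨rfl, rfl, rfl, rfl⟩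

theorem upper_add (b c : 𝒪[F]) : upper (b + c) = upper b * upper c := by
  apply SL2_ext <;> simp [mul_entry, upper_entry, add_comm]

theorem lower_add (ϖ b c : 𝒪[F]) : lower ϖ (b + c) = lower ϖ b * lower ϖ c := by
  apply SL2_ext <;> simp [mul_entry, lower_entry, mul_add]

theorem upper_mem_iwahori (b : 𝒪[F]) : upper b ∈ iwahori F := by
  rw [mem_iwahori_iff]
  simp only [upper_entry]
  exact ⟨by simp, b.2, by simp, by simp⟩

theorem lower_mem_iwahori {ϖ : 𝒪[F]} (hϖ : Irreducible ϖ) (b : 𝒪[F]) :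
    lower ϖ b ∈ iwahori F := by
  rw [mem_iwahori_iff]
  simp only [lower_entry]
  refine ⟨by simp, by simp, ?_, by simp⟩
  rw [map_mul]
  exact mul_lt_one_of_nonneg_of_lt_one_left zero_le (valuation_uniformizer_lt_one hϖ) b.2

/-- The determinant condition reads `g₀₀ g₁₁ = 1 + g₀₁ g₁₀` with `|g₀₁ g₁₀| < 1`, so both diagonal
entries are units. -/
theorem valuation_diag_of_mem_iwahori {g : SL(2, F)} (hg : g ∈ iwahori F) :
    valuation F (g 0 0) = 1 ∧ valuation F (g 1 1) = 1 := by
  obtain ⟨h1, h2, h3, h4⟩ := mem_iwahori_iff.mp hg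
  have h5 : valuation F (g 0 0) * valuation F (g 1 1) = 1 := by
    rw [← map_mul, show g 0 0 * g 1 1 = 1 + g 0 1 * g 1 0 by linear_combination det_eq_one g]
    refine (valuation F).map_one_add_of_lt ?_
    rw [map_mul]
    exact mul_lt_one_of_nonneg_of_lt_one_right h2 zero_le h3
  exact ⟨le_antisymm h1 (h5.symm.trans_le (mul_le_of_le_one_right' h4)),
    le_antisymm h4 (h5.symm.trans_le (mul_le_of_le_one_left' h1))⟩

/-- Iwahori factorization: an upper unipotent clears the upper right entry because `g₁₁` is a unit.
The lower version below works in the same way, with `g₀₀` and the factor `ϖ` already contained in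
`g₁₀`. -/
theorem exists_upper_mul_entry_eq_zero {g : SL(2, F)} (hg : g ∈ iwahori F) :
    ∃ b : 𝒪[F], (upper (-b) * g) 0 1 = 0 := by
  obtain ⟨-, h1⟩ := valuation_diag_of_mem_iwahori hg
  have h0 : g 1 1 ≠ 0 := by
    rintro h0
    simp [h0] at h1
  refine ⟨⟨g 0 1 / g 1 1, ?_⟩, ?_⟩
  · rw [Valuation.mem_integer_iff, map_div₀, h1, div_one]
    exact (mem_iwahori_iff.mp hg).2.1
  · rw [mul_entry]
    simp [upper_entry, h0]

theorem exists_lower_mul_entry_eq_zero [IsDiscreteValuationRing 𝒪[F]] {ϖ : 𝒪[F]}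
    (hϖ : Irreducible ϖ) {g : SL(2, F)} (hg : g ∈ iwahori F) :
    ∃ b : 𝒪[F], (lower ϖ (-b) * g) 1 0 = 0 := by
  obtain ⟨h1, -⟩ := valuation_diag_of_mem_iwahori hg
  have h0 : g 0 0 ≠ 0 := by
    rintro h0
    simp [h0] at h1
  have hs := (mem_iwahori_iff.mp hg).2.2.1
  obtain ⟨c, hc⟩ := (valuation_integer_lt_pow_iff hϖ ⟨g 1 0, hs.le⟩ 0).mp (by simpa using hs)
  have hc' : g 1 0 = ϖ * c := by
    simpa using congrArg (fun y : 𝒪[F] => (y : F)) hc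
  refine ⟨⟨c / g 0 0, ?_⟩, ?_⟩
  · rw [Valuation.mem_integer_iff, map_div₀, h1, div_one]
    exact c.2
  · rw [mul_entry]
    simp only [lower_entry, hc']
    push_cast
    field_simp
    ring

variable {ϖ : F} (hϖ : ϖ ≠ 0)

/-- Conjugation by the diagonal representative fixes the diagonal and scales the off-diagonal
entries by `ϖ^{∓2n}`. For `sr n` it also exchanges opposite entries, which interchanges the strict
and the weak inequality. -/
theorem conj_r_mem_iwahori_iff (n : ℤ) (g : SL(2, F)) :
    (weylRep ϖ hϖ (.r n))⁻¹ * g * weylRep ϖ hϖ (.r n) ∈ iwahori F ↔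
      valuation F (g 0 0) ≤ 1 ∧ valuation F (g 0 1) ≤ valuation F ϖ ^ (2 * n) ∧
      valuation F (g 1 0) < valuation F ϖ ^ (-(2 * n)) ∧ valuation F (g 1 1) ≤ 1 := by
  have hω : 0 < valuation F ϖ := zero_lt_iff.mpr ((valuation F).ne_zero_iff.mpr hϖ)
  rw [mem_iwahori_iff]
  simp only [mul_entry, inv_apply, weylRep_r_entry, neg_zero, zero_mul, mul_zero, add_zero,
    zero_add, map_mul, map_zpow₀]
  have e : ∀ (k l : ℤ) (y : ValueGroupWithZero F),
      valuation F ϖ ^ k * y * valuation F ϖ ^ l = y * valuation F ϖ ^ (k + l) := by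
    intro k l y
    rw [zpow_add₀ hω.ne', mul_comm (_ ^ k) y, mul_assoc]
  rw [e, e, e, e, neg_add_cancel, add_neg_cancel, zpow_zero, mul_one, mul_one, zpow_neg _ (2 * n),
    ← le_div_iff₀ (zpow_pos hω _), ← lt_div_iff₀ (zpow_pos hω _), ← neg_add, ← two_mul, zpow_neg,
    one_div, inv_inv, one_div]

theorem conj_sr_mem_iwahori_iff (n : ℤ) (g : SL(2, F)) :
    (weylRep ϖ hϖ (.sr n))⁻¹ * g * weylRep ϖ hϖ (.sr n) ∈ iwahori F ↔
      valuation F (g 1 1) ≤ 1 ∧ valuation F (g 1 0) ≤ valuation F ϖ ^ (2 * n) ∧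
      valuation F (g 0 1) < valuation F ϖ ^ (-(2 * n)) ∧ valuation F (g 0 0) ≤ 1 := by
  have hω : 0 < valuation F ϖ := zero_lt_iff.mpr ((valuation F).ne_zero_iff.mpr hϖ)
  rw [mem_iwahori_iff]
  simp only [mul_entry, inv_apply, weylRep_sr_entry, zero_mul, mul_zero, add_zero,
    zero_add, neg_neg, neg_mul, mul_neg, Valuation.map_neg, map_mul, map_zpow₀]
  have e : ∀ (k l : ℤ) (y : ValueGroupWithZero F),
      valuation F ϖ ^ k * y * valuation F ϖ ^ l = y * valuation F ϖ ^ (k + l) := by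
    intro k l y
    rw [zpow_add₀ hω.ne', mul_comm (_ ^ k) y, mul_assoc]
  rw [e, e, e, e, neg_add_cancel, add_neg_cancel, zpow_zero, mul_one, mul_one, zpow_neg _ (2 * n),
    ← le_div_iff₀ (zpow_pos hω _), ← lt_div_iff₀ (zpow_pos hω _), ← neg_add, ← two_mul, zpow_neg,
    one_div, inv_inv, one_div]

end Convolution

/-! ## The convolution with the characteristic functions of the orbits -/

section Orbits

variable {F : Type*} [Field F]

/-- The point `(ϖ^k, 0)`. -/
def pointX {ϖ : F} (hϖ : ϖ ≠ 0) (k : ℤ) : Plane F :=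
  ⟨![ϖ ^ k, 0], fun h0 => zpow_ne_zero k hϖ (congrFun h0 0)⟩

/-- The point `(0, ϖ^k)`. -/
def pointY {ϖ : F} (hϖ : ϖ ≠ 0) (k : ℤ) : Plane F :=
  ⟨![0, ϖ ^ k], fun h0 => zpow_ne_zero k hϖ (congrFun h0 1)⟩

theorem pointX_apply {ϖ : F} (hϖ : ϖ ≠ 0) (k : ℤ) :
    (pointX hϖ k).1 0 = ϖ ^ k ∧ (pointX hϖ k).1 1 = 0 := ⟨rfl, rfl⟩

theorem pointY_apply {ϖ : F} (hϖ : ϖ ≠ 0) (k : ℤ) :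
    (pointY hϖ k).1 0 = 0 ∧ (pointY hϖ k).1 1 = ϖ ^ k := ⟨rfl, rfl⟩

theorem exists_SL2_entry {a b c d : F} (hdet : a * d - b * c = 1) :
    ∃ g : SL(2, F), g 0 0 = a ∧ g 0 1 = b ∧ g 1 0 = c ∧ g 1 1 = d :=
  ⟨⟨!![a, b; c, d], by rw [Matrix.det_fin_two_of, hdet]⟩, rfl, rfl, rfl, rfl⟩

variable [ValuativeRel F]

/-- The `I`-orbit `(ϖ^m 𝒪ˣ, ϖ^{m+1} 𝒪)`. -/
def psiOrbit (ϖ : F) (m : ℤ) : Set (Plane F) :=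
  {x | valuation F (x.1 0) = valuation F ϖ ^ m ∧ valuation F (x.1 1) ≤ valuation F ϖ ^ (m + 1)}

/-- The `I`-orbit `(ϖ^m 𝒪, ϖ^m 𝒪ˣ)`. -/
def phiOrbit (ϖ : F) (m : ℤ) : Set (Plane F) :=
  {x | valuation F (x.1 0) ≤ valuation F ϖ ^ m ∧ valuation F (x.1 1) = valuation F ϖ ^ m}

theorem zpow_pos_of_irreducible {ϖ : 𝒪[F]} (hϖ : Irreducible ϖ) (k : ℤ) :
    0 < valuation F (ϖ : F) ^ k := zpow_pos (valuation_uniformizer_pos hϖ) k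

theorem zpow_le_zpow_iff {ϖ : 𝒪[F]} (hϖ : Irreducible ϖ) {k l : ℤ} :
    valuation F (ϖ : F) ^ k ≤ valuation F (ϖ : F) ^ l ↔ l ≤ k :=
  zpow_le_zpow_iff_right_of_lt_one₀ (valuation_uniformizer_pos hϖ) (valuation_uniformizer_lt_one hϖ)

theorem zpow_lt_zpow_iff {ϖ : 𝒪[F]} (hϖ : Irreducible ϖ) {k l : ℤ} :
    valuation F (ϖ : F) ^ k < valuation F (ϖ : F) ^ l ↔ l < k :=
  zpow_lt_zpow_iff_right_of_lt_one₀ (valuation_uniformizer_pos hϖ) (valuation_uniformizer_lt_one hϖ)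

theorem zpow_eq_zpow_iff {ϖ : 𝒪[F]} (hϖ : Irreducible ϖ) {k l : ℤ} :
    valuation F (ϖ : F) ^ k = valuation F (ϖ : F) ^ l ↔ k = l :=
  (zpow_right_injective₀ (valuation_uniformizer_pos hϖ)
    (valuation_uniformizer_lt_one hϖ).ne).eq_iff

theorem one_le_zpow_neg {ϖ : 𝒪[F]} (hϖ : Irreducible ϖ) {k : ℤ} (hk : k ≤ 0) :
    1 ≤ valuation F (ϖ : F) ^ k := by
  rw [← zpow_zero (valuation F (ϖ : F)), zpow_le_zpow_iff hϖ]
  exact hk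

theorem psiOrbit_isIwahoriInvariant {ϖ : 𝒪[F]} (hϖ : Irreducible ϖ)
    [IsDiscreteValuationRing 𝒪[F]] (m : ℤ) : IsIwahoriInvariant (psiOrbit (ϖ : F) m) := by
  rintro g hg x ⟨h0, h1⟩
  obtain ⟨-, g01, g10, -⟩ := mem_iwahori_iff.mp hg
  obtain ⟨g00, g11⟩ := valuation_diag_of_mem_iwahori hg
  have g10' : valuation F (g 1 0) ≤ valuation F (ϖ : F) ^ (1 : ℤ) := by
    have := (valuation_integer_lt_pow_iff hϖ ⟨g 1 0, g10.le⟩ 0).mp (by simpa using g10)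
    simpa using (valuation_integer_le_pow_iff ϖ _ _).mpr this
  refine ⟨?_, ?_⟩
  · rw [act_apply_zero, Valuation.map_add_eq_of_lt_left, map_mul, g00, one_mul, h0]
    rw [map_mul, map_mul, g00, one_mul, h0]
    refine (mul_le_of_le_one_left' g01).trans_lt (h1.trans_lt ?_)
    rw [zpow_lt_zpow_iff hϖ]
    exact lt_add_one m
  · rw [act_apply_one]
    refine (valuation F).map_add_le ?_ ?_
    · rw [map_mul, h0, add_comm m 1, zpow_add₀ (valuation_uniformizer_pos hϖ).ne']
      exact mul_le_mul_left g10' _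
    · rwa [map_mul, g11, one_mul]

theorem phiOrbit_isIwahoriInvariant {ϖ : 𝒪[F]} (hϖ : Irreducible ϖ) (m : ℤ) :
    IsIwahoriInvariant (phiOrbit (ϖ : F) m) := by
  rintro g hg x ⟨h0, h1⟩
  obtain ⟨-, g01, g10, -⟩ := mem_iwahori_iff.mp hg
  obtain ⟨g00, g11⟩ := valuation_diag_of_mem_iwahori hg
  refine ⟨?_, ?_⟩
  · rw [act_apply_zero]
    refine (valuation F).map_add_le ?_ ?_
    · rwa [map_mul, g00, one_mul]
    · rw [map_mul, h1]
      exact mul_le_of_le_one_left' g01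
  · rw [act_apply_one, Valuation.map_add_eq_of_lt_right, map_mul, g11, one_mul, h1]
    rw [map_mul, map_mul, g11, one_mul, h1]
    rcases eq_or_ne (valuation F (x.1 0)) 0 with hx | hx
    · rw [hx, mul_zero]
      exact zpow_pos_of_irreducible hϖ m
    · exact (mul_lt_of_lt_one_left (zero_lt_iff.mpr hx) g10).trans_le h0

variable [TopologicalSpace F] [IsNonarchimedeanLocalField F]

theorem exists_valuation_eq_zpow {ϖ : 𝒪[F]} (hϖ : Irreducible ϖ) {y : F} (hy : y ≠ 0) :
    ∃ k : ℤ, valuation F y = valuation F (ϖ : F) ^ k := by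
  have key : ∀ b : 𝒪[F], b ≠ 0 → ∃ k : ℤ, valuation F (b : F) = valuation F (ϖ : F) ^ k := by
    intro b hb
    obtain ⟨n, u, rfl⟩ := IsDiscreteValuationRing.eq_unit_mul_pow_irreducible hb hϖ
    have hu := (Valuation.integer.integers (valuation F)).one_of_isUnit u.isUnit
    have hu' : valuation F ((u : 𝒪[F]) : F) = 1 := hu
    exact ⟨n, by simp [hu']⟩
  rcases le_total (valuation F y) 1 with h1 | h1
  · exact key ⟨y, h1⟩ fun h0 => hy (congrArg Subtype.val h0)
  · have hy' : valuation F y⁻¹ ≤ 1 := by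
      rw [map_inv₀]
      exact inv_le_one_of_one_le₀ h1
    obtain ⟨k, hk⟩ := key ⟨y⁻¹, hy'⟩ fun h0 => inv_ne_zero hy (congrArg Subtype.val h0)
    refine ⟨-k, ?_⟩
    rw [zpow_neg, ← hk, map_inv₀, inv_inv]

/-- Representatives for the `I`-orbits on the punctured plane. -/
theorem exists_eq_act_point {ϖ : 𝒪[F]} (hϖ : Irreducible ϖ) (x : Plane F) :
    ∃ i ∈ iwahori F, ∃ k, x = act i (pointX (uniformizer_ne_zero hϖ) k) ∨
      x = act i (pointY (uniformizer_ne_zero hϖ) k) := by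
  have hϖ0 := uniformizer_ne_zero hϖ
  -- The coordinate of larger valuation norm, with ties going to the second one, decides the type of
  -- orbit; the strict inequality is needed for the lower left entry `x₁/ϖ^k` to lie in the maximal
  -- ideal.
  rcases lt_or_ge (valuation F (x.1 1)) (valuation F (x.1 0)) with hlt | hle
  · have hx0 : x.1 0 ≠ 0 := (valuation F).ne_zero_iff.mp (zero_le.trans_lt hlt).ne'
    obtain ⟨k, hk⟩ := exists_valuation_eq_zpow hϖ hx0
    have hpk : (ϖ : F) ^ k ≠ 0 := zpow_ne_zero k hϖ0
    obtain ⟨g, h00, h01, h10, h11⟩ := exists_SL2_entry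
      (show x.1 0 / (ϖ : F) ^ k * (ϖ ^ k / x.1 0) - 0 * (x.1 1 / ϖ ^ k) = 1 by field_simp; ring)
    refine ⟨g, ?_, k, Or.inl ?_⟩
    · rw [mem_iwahori_iff, h00, h01, h10, h11]
      have hω := zpow_pos_of_irreducible hϖ k
      refine ⟨?_, by simp, ?_, ?_⟩
      · rw [map_div₀, map_zpow₀, hk, div_self hω.ne']
      · rw [map_div₀, map_zpow₀, div_lt_one₀ hω, ← hk]
        exact hlt
      · rw [map_div₀, map_zpow₀, hk, div_self hω.ne']
    · apply plane_ext
      · rw [act_apply_zero, h00, h01]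
        simp [pointX_apply, hpk]
      · rw [act_apply_one, h10, h11]
        simp [pointX_apply, hpk]
  · have hx1 : x.1 1 ≠ 0 := by
      intro h1
      rw [h1, map_zero, le_zero_iff, map_eq_zero] at hle
      refine x.2 (funext fun i => ?_)
      fin_cases i
      · exact hle
      · exact h1
    obtain ⟨k, hk⟩ := exists_valuation_eq_zpow hϖ hx1
    have hpk : (ϖ : F) ^ k ≠ 0 := zpow_ne_zero k hϖ0
    obtain ⟨g, h00, h01, h10, h11⟩ := exists_SL2_entry
      (show (ϖ : F) ^ k / x.1 1 * (x.1 1 / ϖ ^ k) - x.1 0 / ϖ ^ k * 0 = 1 by field_simp; ring)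
    refine ⟨g, ?_, k, Or.inr ?_⟩
    · rw [mem_iwahori_iff, h00, h01, h10, h11]
      have hω := zpow_pos_of_irreducible hϖ k
      refine ⟨?_, ?_, by simp, ?_⟩
      · rw [map_div₀, map_zpow₀, hk, div_self hω.ne']
      · rw [map_div₀, map_zpow₀, div_le_one₀ hω, ← hk]
        exact hle
      · rw [map_div₀, map_zpow₀, hk, div_self hω.ne']
    · apply plane_ext
      · rw [act_apply_zero, h00, h01]
        simp [pointY_apply, hpk]
      · rw [act_apply_one, h10, h11]
        simp [pointY_apply, hpk]

/-- For `w` with first letter `s₀` (here and for `sr (-n)`), upper unipotents sweep out the cell;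
for first letter `s₁`, lower ones do. The modulus is `ϖ^{ℓ(w)}` in all four cases. -/
theorem conv_r_eq_ncard {ϖ : 𝒪[F]} (hϖ : Irreducible ϖ) {S : Set (Plane F)}
    (hS : IsIwahoriInvariant S) (n : ℕ) (x : Plane F) :
    conv (ϖ : F) (uniformizer_ne_zero hϖ) (.r (n : ℤ)) (S.indicator 1) x =
      {c : Residues ϖ (2 * n) | act (upper c.lift *
        weylRep (ϖ : F) (uniformizer_ne_zero hϖ) (.r (n : ℤ)))⁻¹ x ∈ S}.ncard := by
  have := finite_residues hϖ (2 * n)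
  refine conv_eq_ncard _ hS upper_add upper_mem_iwahori (fun b => ?_) (fun i hi => ?_) x
  · rw [conj_r_mem_iwahori_iff, ← valuation_integer_le_pow_iff, ← zpow_natCast]
    simp [upper_entry, zpow_pos_of_irreducible hϖ]
  · obtain ⟨b, hb⟩ := exists_upper_mul_entry_eq_zero hi
    obtain ⟨h1, -, h3, h4⟩ := mem_iwahori_iff.mp (mul_mem (upper_mem_iwahori (-b)) hi)
    refine ⟨b, (conj_r_mem_iwahori_iff _ _ _).mpr ⟨h1, ?_, h3.trans_le ?_, h4⟩⟩
    · rw [hb, map_zero]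
      exact zero_le
    · exact one_le_zpow_neg hϖ (by omega)

theorem conv_sr_neg_eq_ncard {ϖ : 𝒪[F]} (hϖ : Irreducible ϖ) {S : Set (Plane F)}
    (hS : IsIwahoriInvariant S) (n : ℕ) (x : Plane F) :
    conv (ϖ : F) (uniformizer_ne_zero hϖ) (.sr (-n : ℤ)) (S.indicator 1) x =
      {c : Residues ϖ (2 * n + 1) | act (upper c.lift *
        weylRep (ϖ : F) (uniformizer_ne_zero hϖ) (.sr (-n : ℤ)))⁻¹ x ∈ S}.ncard := by
  have := finite_residues hϖ (2 * n + 1)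
  refine conv_eq_ncard _ hS upper_add upper_mem_iwahori (fun b => ?_) (fun i hi => ?_) x
  -- Strictness, `|b| < |ϖ|^{2n}`, supplies the extra power in the odd length `2n + 1`.
  · rw [conj_sr_mem_iwahori_iff, ← valuation_integer_lt_pow_iff hϖ, ← zpow_natCast]
    simp [upper_entry]
  · obtain ⟨b, hb⟩ := exists_upper_mul_entry_eq_zero hi
    obtain ⟨h1, -, h3, h4⟩ := mem_iwahori_iff.mp (mul_mem (upper_mem_iwahori (-b)) hi)
    refine ⟨b, (conj_sr_mem_iwahori_iff _ _ _).mpr ⟨h4, h3.le.trans ?_, ?_, h1⟩⟩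
    · exact one_le_zpow_neg hϖ (by omega)
    · rw [hb, map_zero]
      exact zpow_pos_of_irreducible hϖ _

theorem conv_r_neg_eq_ncard {ϖ : 𝒪[F]} (hϖ : Irreducible ϖ) {S : Set (Plane F)}
    (hS : IsIwahoriInvariant S) (n : ℕ) (x : Plane F) :
    conv (ϖ : F) (uniformizer_ne_zero hϖ) (.r (-n : ℤ)) (S.indicator 1) x =
      {c : Residues ϖ (2 * n) | act (lower ϖ c.lift *
        weylRep (ϖ : F) (uniformizer_ne_zero hϖ) (.r (-n : ℤ)))⁻¹ x ∈ S}.ncard := by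
  have := finite_residues hϖ (2 * n)
  refine conv_eq_ncard _ hS (lower_add ϖ) (lower_mem_iwahori hϖ) (fun b => ?_) (fun i hi => ?_) x
  -- The entry of `lower ϖ b` is `ϖ b`, so `ϖ^{2n} ∣ b` is rewritten as `ϖ^{2n+1} ∣ ϖ b`, i.e. the
  -- strict bound `|ϖ b| < |ϖ|^{2n}`.
  · rw [conj_r_mem_iwahori_iff, ← mul_dvd_mul_iff_left hϖ.ne_zero, ← pow_succ',
      ← valuation_integer_lt_pow_iff hϖ, ← zpow_natCast]
    simp [lower_entry]
  · obtain ⟨b, hb⟩ := exists_lower_mul_entry_eq_zero hϖ hi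
    obtain ⟨h1, h2, -, h4⟩ := mem_iwahori_iff.mp (mul_mem (lower_mem_iwahori hϖ (-b)) hi)
    refine ⟨b, (conj_r_mem_iwahori_iff _ _ _).mpr ⟨h1, h2.trans ?_, ?_, h4⟩⟩
    · exact one_le_zpow_neg hϖ (by omega)
    · rw [hb, map_zero]
      exact zpow_pos_of_irreducible hϖ _

theorem conv_sr_eq_ncard {ϖ : 𝒪[F]} (hϖ : Irreducible ϖ) {S : Set (Plane F)}
    (hS : IsIwahoriInvariant S) (n : ℕ) (x : Plane F) :
    conv (ϖ : F) (uniformizer_ne_zero hϖ) (.sr (n + 1 : ℤ)) (S.indicator 1) x =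
      {c : Residues ϖ (2 * n + 1) | act (lower ϖ c.lift *
        weylRep (ϖ : F) (uniformizer_ne_zero hϖ) (.sr (n + 1 : ℤ)))⁻¹ x ∈ S}.ncard := by
  have := finite_residues hϖ (2 * n + 1)
  refine conv_eq_ncard _ hS (lower_add ϖ) (lower_mem_iwahori hϖ) (fun b => ?_) (fun i hi => ?_) x
  · rw [conj_sr_mem_iwahori_iff, ← mul_dvd_mul_iff_left hϖ.ne_zero, ← pow_succ',
      ← valuation_integer_le_pow_iff, ← zpow_natCast,
      show ((2 * n + 1 + 1 : ℕ) : ℤ) = 2 * (n + 1) by push_cast; ring]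
    simp only [lower_entry, map_zero, map_one, le_refl, true_and, and_true,
      zpow_pos_of_irreducible hϖ]
    rfl
  · obtain ⟨b, hb⟩ := exists_lower_mul_entry_eq_zero hϖ hi
    obtain ⟨h1, h2, -, h4⟩ := mem_iwahori_iff.mp (mul_mem (lower_mem_iwahori hϖ (-b)) hi)
    refine ⟨b, (conj_sr_mem_iwahori_iff _ _ _).mpr ⟨h4, ?_, h2.trans_lt ?_, h1⟩⟩
    · rw [hb, map_zero]
      exact zero_le
    · rw [← zpow_zero (valuation F (ϖ : F)), zpow_lt_zpow_iff hϖ]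
      omega

end Orbits

/-! ### The individual terms of the series at the orbit representatives -/

/-- The weight `(-q)^{-ℓ(w)}` of `T_w` in `g`, for a number `q`. -/
def weight (q : ℂ) (w : W) : ℂ := (-1) ^ length w * q ^ (-(length w : ℤ))

theorem weight_r (q : ℂ) (n : ℕ) : weight q (.r (n : ℤ)) = q ^ (-(2 * n : ℤ)) := by
  rw [weight, ← elt_zero_even, length_elt, pow_mul]
  simp

theorem weight_r_neg (q : ℂ) (n : ℕ) : weight q (.r (-n : ℤ)) = q ^ (-(2 * n : ℤ)) := by
  rw [weight, ← elt_one_even, length_elt, pow_mul]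
  simp

theorem weight_sr_neg (q : ℂ) (n : ℕ) : weight q (.sr (-n : ℤ)) = -q ^ (-(2 * n + 1 : ℤ)) := by
  rw [weight, ← elt_zero_odd, length_elt, pow_succ, pow_mul]
  simp

theorem weight_sr (q : ℂ) (n : ℕ) : weight q (.sr (n + 1 : ℤ)) = -q ^ (-(2 * n + 1 : ℤ)) := by
  rw [weight, ← elt_one_odd, length_elt, pow_succ, pow_mul]
  simp

section Evaluation

variable {F : Type*} [Field F] [ValuativeRel F] {ϖ : 𝒪[F]} (hϖ : Irreducible ϖ)

theorem valuation_act_upper_r (b : 𝒪[F]) (n k : ℤ) :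
    (valuation F ((act (upper b * weylRep (ϖ : F) (uniformizer_ne_zero hϖ) (.r n))⁻¹
      (pointX (uniformizer_ne_zero hϖ) k)).1 0) = valuation F (ϖ : F) ^ (k - n) ∧
    valuation F ((act (upper b * weylRep (ϖ : F) (uniformizer_ne_zero hϖ) (.r n))⁻¹
      (pointX (uniformizer_ne_zero hϖ) k)).1 1) = 0) ∧
    (valuation F ((act (upper b * weylRep (ϖ : F) (uniformizer_ne_zero hϖ) (.r n))⁻¹
      (pointY (uniformizer_ne_zero hϖ) k)).1 0) =
        valuation F (b : F) * valuation F (ϖ : F) ^ (k - n) ∧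
    valuation F ((act (upper b * weylRep (ϖ : F) (uniformizer_ne_zero hϖ) (.r n))⁻¹
      (pointY (uniformizer_ne_zero hϖ) k)).1 1) = valuation F (ϖ : F) ^ (k + n)) := by
  have hω := (valuation_uniformizer_pos hϖ).ne'
  simp only [act_inv_apply_zero, act_inv_apply_one, mul_entry, upper_entry, weylRep_r_entry,
    pointX_apply, pointY_apply, mul_zero, zero_mul, one_mul, add_zero, zero_add, sub_zero,
    zero_sub, neg_zero, map_zero, Valuation.map_neg, map_mul, map_zpow₀, and_true, mul_assoc,
    ← zpow_add₀ hω, neg_add_eq_sub, add_comm n k]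

theorem valuation_act_upper_sr (b : 𝒪[F]) (n k : ℤ) :
    (valuation F ((act (upper b * weylRep (ϖ : F) (uniformizer_ne_zero hϖ) (.sr n))⁻¹
      (pointX (uniformizer_ne_zero hϖ) k)).1 0) = 0 ∧
    valuation F ((act (upper b * weylRep (ϖ : F) (uniformizer_ne_zero hϖ) (.sr n))⁻¹
      (pointX (uniformizer_ne_zero hϖ) k)).1 1) = valuation F (ϖ : F) ^ (k + n)) ∧
    (valuation F ((act (upper b * weylRep (ϖ : F) (uniformizer_ne_zero hϖ) (.sr n))⁻¹
      (pointY (uniformizer_ne_zero hϖ) k)).1 0) = valuation F (ϖ : F) ^ (k - n) ∧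
    valuation F ((act (upper b * weylRep (ϖ : F) (uniformizer_ne_zero hϖ) (.sr n))⁻¹
      (pointY (uniformizer_ne_zero hϖ) k)).1 1) =
        valuation F (b : F) * valuation F (ϖ : F) ^ (k + n)) := by
  have hω := (valuation_uniformizer_pos hϖ).ne'
  simp only [act_inv_apply_zero, act_inv_apply_one, mul_entry, upper_entry, weylRep_sr_entry,
    pointX_apply, pointY_apply, mul_zero, zero_mul, one_mul, add_zero, zero_add, sub_zero,
    zero_sub, neg_zero, map_zero, Valuation.map_neg, map_mul, map_zpow₀, and_true, mul_assoc,
    ← zpow_add₀ hω, neg_add_eq_sub, add_comm n k, neg_mul, neg_neg]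

theorem valuation_act_lower_r (b : 𝒪[F]) (n k : ℤ) :
    (valuation F ((act (lower ϖ b * weylRep (ϖ : F) (uniformizer_ne_zero hϖ) (.r n))⁻¹
      (pointX (uniformizer_ne_zero hϖ) k)).1 0) = valuation F (ϖ : F) ^ (k - n) ∧
    valuation F ((act (lower ϖ b * weylRep (ϖ : F) (uniformizer_ne_zero hϖ) (.r n))⁻¹
      (pointX (uniformizer_ne_zero hϖ) k)).1 1) =
        valuation F (b : F) * valuation F (ϖ : F) ^ (k + n + 1)) ∧
    (valuation F ((act (lower ϖ b * weylRep (ϖ : F) (uniformizer_ne_zero hϖ) (.r n))⁻¹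
      (pointY (uniformizer_ne_zero hϖ) k)).1 0) = 0 ∧
    valuation F ((act (lower ϖ b * weylRep (ϖ : F) (uniformizer_ne_zero hϖ) (.r n))⁻¹
      (pointY (uniformizer_ne_zero hϖ) k)).1 1) = valuation F (ϖ : F) ^ (k + n)) := by
  have hω := (valuation_uniformizer_pos hϖ).ne'
  simp only [act_inv_apply_zero, act_inv_apply_one, mul_entry, lower_entry, weylRep_r_entry,
    pointX_apply, pointY_apply, mul_zero, zero_mul, one_mul, add_zero, zero_add, sub_zero,
    neg_zero, map_zero, Valuation.map_neg, map_mul, map_zpow₀, and_true, mul_assoc,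
    ← zpow_add₀ hω, neg_add_eq_sub, add_comm n k, true_and]
  rw [mul_left_comm, zpow_add_one₀ hω, mul_comm (valuation F (ϖ : F))]

theorem valuation_act_lower_sr (b : 𝒪[F]) (n k : ℤ) :
    (valuation F ((act (lower ϖ b * weylRep (ϖ : F) (uniformizer_ne_zero hϖ) (.sr n))⁻¹
      (pointX (uniformizer_ne_zero hϖ) k)).1 0) =
        valuation F (b : F) * valuation F (ϖ : F) ^ (k - n + 1) ∧
    valuation F ((act (lower ϖ b * weylRep (ϖ : F) (uniformizer_ne_zero hϖ) (.sr n))⁻¹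
      (pointX (uniformizer_ne_zero hϖ) k)).1 1) = valuation F (ϖ : F) ^ (k + n)) ∧
    (valuation F ((act (lower ϖ b * weylRep (ϖ : F) (uniformizer_ne_zero hϖ) (.sr n))⁻¹
      (pointY (uniformizer_ne_zero hϖ) k)).1 0) = valuation F (ϖ : F) ^ (k - n) ∧
    valuation F ((act (lower ϖ b * weylRep (ϖ : F) (uniformizer_ne_zero hϖ) (.sr n))⁻¹
      (pointY (uniformizer_ne_zero hϖ) k)).1 1) = 0) := by
  have hω := (valuation_uniformizer_pos hϖ).ne'
  simp only [act_inv_apply_zero, act_inv_apply_one, mul_entry, lower_entry, weylRep_sr_entry,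
    pointX_apply, pointY_apply, mul_zero, zero_mul, one_mul, add_zero, zero_add, sub_zero,
    zero_sub, neg_zero, map_zero, Valuation.map_neg, map_mul, map_zpow₀, and_true, mul_assoc,
    ← zpow_add₀ hω, neg_add_eq_sub, add_comm n k, neg_mul, neg_neg, mul_neg]
  rw [mul_left_comm, zpow_add_one₀ hω, mul_comm (valuation F (ϖ : F))]

variable [TopologicalSpace F] [IsNonarchimedeanLocalField F]

theorem card_residueField_ne_zero : (Nat.card 𝓀[F] : ℂ) ≠ 0 := by
  have := one_lt_card_residueField (F := F)
  exact_mod_cast (by omega : Nat.card 𝓀[F] ≠ 0)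

/-- Counts residues of exact valuation `m - e`. The bound `m - e < ℓ` makes the condition
independent of the lift; for negative `m - e` integrality of the lift leaves nothing. -/
theorem ncard_mul_zpow_eq (hϖ : Irreducible ϖ) {ℓ : ℕ} (e m : ℤ) (hℓ : m - e < ℓ) :
    ({c : Residues ϖ ℓ | valuation F (c.lift : F) * valuation F (ϖ : F) ^ e =
      valuation F (ϖ : F) ^ m}.ncard : ℂ) =
    if 0 ≤ m - e then (1 - (Nat.card 𝓀[F] : ℂ)⁻¹) * (Nat.card 𝓀[F] : ℂ) ^ (ℓ - (m - e)) else 0 := by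
  have hω := (valuation_uniformizer_pos hϖ).ne'
  have hQ := card_residueField_ne_zero (F := F)
  simp only [← eq_div_iff (zpow_ne_zero e hω), ← zpow_sub₀ hω]
  split_ifs with h0
  · obtain ⟨r, hr⟩ := Int.eq_ofNat_of_zero_le h0
    rw [hr] at hℓ ⊢
    simp only [zpow_natCast]
    have hr' : r < ℓ := by omega
    rw [ncard_residues_eq hϖ hr', show (ℓ : ℤ) - r = ((ℓ - r - 1 : ℕ) : ℤ) + 1 by omega,
      zpow_add_one₀ hQ, zpow_natCast, Nat.cast_mul, Nat.cast_sub one_lt_card_residueField.le,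
      Nat.cast_pow, Nat.cast_one]
    field_simp
  · rw [Nat.cast_eq_zero]
    convert Set.ncard_empty (Residues ϖ ℓ)
    refine Set.eq_empty_of_forall_notMem fun c hc => h0 ?_
    rw [← zpow_le_zpow_iff hϖ, zpow_zero, ← (hc : _ = _)]
    exact c.lift.2

theorem ncard_mul_zpow_le (hϖ : Irreducible ϖ) {ℓ : ℕ} (e m : ℤ) (hℓ : m - e = ℓ) :
    {c : Residues ϖ ℓ | valuation F (c.lift : F) * valuation F (ϖ : F) ^ e ≤
      valuation F (ϖ : F) ^ m}.ncard = 1 := by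
  have hω := (valuation_uniformizer_pos hϖ).ne'
  simp only [← le_div_iff₀ (zpow_pos_of_irreducible hϖ e), ← zpow_sub₀ hω, hℓ, zpow_natCast]
  rw [ncard_residues_le hϖ le_rfl, Nat.sub_self, pow_zero]

theorem ncard_residues_const (hϖ : Irreducible ϖ) (ℓ : ℕ) (p : Prop) [Decidable p] :
    ({_c : Residues ϖ ℓ | p}.ncard : ℂ) = if p then (Nat.card 𝓀[F] : ℂ) ^ (ℓ : ℤ) else 0 := by
  split_ifs with hp
  · simp only [hp, Set.ofPred_true, Set.ncard_univ, card_residues hϖ, zpow_natCast, Nat.cast_pow]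
  · simp only [hp, Set.ofPred_false, Set.ncard_empty, Nat.cast_zero]

theorem ncard_residues_and_le (hϖ : Irreducible ϖ) {ℓ : ℕ} {p : Prop} [Decidable p] {e m : ℤ}
    (hℓ : p → m - e = ℓ) : ({c : Residues ϖ ℓ | p ∧
      valuation F (c.lift : F) * valuation F (ϖ : F) ^ e ≤ valuation F (ϖ : F) ^ m}.ncard : ℂ) =
      if p then (Nat.card 𝓀[F] : ℂ) ^ (0 : ℤ) else 0 := by
  split_ifs with hp
  · simp only [hp, true_and, ncard_mul_zpow_le hϖ e m (hℓ hp), zpow_zero, Nat.cast_one]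
  · simp only [hp, false_and, Set.ofPred_false, Set.ncard_empty, Nat.cast_zero]

/-- One coordinate of the point gives a condition `p` not involving the residue. The valuation in
the other coordinate need be in range only when `p` holds, which is where the bound comes from in
the applications. -/
theorem ncard_residues_and_eq (hϖ : Irreducible ϖ) {ℓ : ℕ} {p : Prop} [Decidable p] {e m : ℤ}
    (hℓ : p → m - e < ℓ) : ({c : Residues ϖ ℓ | p ∧
      valuation F (c.lift : F) * valuation F (ϖ : F) ^ e = valuation F (ϖ : F) ^ m}.ncard : ℂ) =
      if p ∧ 0 ≤ m - e then
        (1 - (Nat.card 𝓀[F] : ℂ)⁻¹) * (Nat.card 𝓀[F] : ℂ) ^ (ℓ - (m - e)) else 0 := by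
  by_cases hp : p
  · simp only [hp, true_and]
    exact ncard_mul_zpow_eq hϖ e m (hℓ hp)
  · simp only [hp, false_and, Set.ofPred_false, Set.ncard_empty, Nat.cast_zero, if_false]

theorem mul_ite_zpow_eq {p p' : Prop} [Decidable p] [Decidable p'] {q c : ℂ} (hq : q ≠ 0)
    {e k l : ℤ} (hp : p ↔ p') (he : p → e + k = l) :
    q ^ e * (if p then c * q ^ k else 0) = if p' then c * q ^ l else 0 := by
  by_cases h : p
  · rw [if_pos h, if_pos (hp.mp h), mul_left_comm, ← zpow_add₀ hq, he h]
  · rw [if_neg h, if_neg (h ∘ hp.mpr), mul_zero]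

theorem mul_ite_zpow_eq' {p p' : Prop} [Decidable p] [Decidable p'] {q : ℂ} (hq : q ≠ 0)
    {e k l : ℤ} (hp : p ↔ p') (he : p → e + k = l) :
    q ^ e * (if p then q ^ k else 0) = if p' then q ^ l else 0 := by
  simpa only [one_mul] using mul_ite_zpow_eq (c := 1) hq hp he

/-- This and the following lemmas follow one pattern. A coordinate that is zero gives either an
empty or a vacuous condition; one not involving `b` fixes or bounds `n`; one involving `b` counts
residues. Multiplying by the weight leaves the power of `q` shown. -/
theorem weight_mul_conv_r_psi_X (m k : ℤ) (n : ℕ) : weight (Nat.card 𝓀[F]) (.r (n : ℤ)) *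
    conv (ϖ : F) (uniformizer_ne_zero hϖ) (.r (n : ℤ)) ((psiOrbit (ϖ : F) m).indicator 1)
      (pointX (uniformizer_ne_zero hϖ) k) =
    if (n : ℤ) = k - m then (Nat.card 𝓀[F] : ℂ) ^ (0 : ℤ) else 0 := by
  rw [conv_r_eq_ncard hϖ (psiOrbit_isIwahoriInvariant hϖ m), weight_r]
  simp only [psiOrbit, Set.mem_ofPred_eq, valuation_act_upper_r hϖ, zpow_eq_zpow_iff hϖ, zero_le,
    and_true]
  rw [ncard_residues_const hϖ]
  exact mul_ite_zpow_eq' card_residueField_ne_zero (by omega) (by omega)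

theorem weight_mul_conv_r_neg_psi_X (m k : ℤ) (n : ℕ) : weight (Nat.card 𝓀[F]) (.r (-n : ℤ)) *
    conv (ϖ : F) (uniformizer_ne_zero hϖ) (.r (-n : ℤ)) ((psiOrbit (ϖ : F) m).indicator 1)
      (pointX (uniformizer_ne_zero hϖ) k) =
    if (n : ℤ) = m - k then (Nat.card 𝓀[F] : ℂ) ^ (-(2 * n) : ℤ) else 0 := by
  rw [conv_r_neg_eq_ncard hϖ (psiOrbit_isIwahoriInvariant hϖ m), weight_r_neg]
  simp only [psiOrbit, Set.mem_ofPred_eq, valuation_act_lower_r hϖ, zpow_eq_zpow_iff hϖ]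
  rw [ncard_residues_and_le hϖ (by omega)]
  exact mul_ite_zpow_eq' card_residueField_ne_zero (by omega) (by omega)

theorem weight_mul_conv_sr_psi_X (m k : ℤ) (n : ℕ) : weight (Nat.card 𝓀[F]) (.sr (n + 1 : ℤ)) *
    conv (ϖ : F) (uniformizer_ne_zero hϖ) (.sr (n + 1 : ℤ)) ((psiOrbit (ϖ : F) m).indicator 1)
      (pointX (uniformizer_ne_zero hϖ) k) =
    -if (m - k).natAbs ≤ n then (1 - (Nat.card 𝓀[F] : ℂ)⁻¹) * (Nat.card 𝓀[F] : ℂ) ^ (-(m - k) - n)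
      else 0 := by
  rw [conv_sr_eq_ncard hϖ (psiOrbit_isIwahoriInvariant hϖ m), weight_sr, neg_mul]
  simp only [psiOrbit, Set.mem_ofPred_eq, valuation_act_lower_sr hϖ, zpow_le_zpow_iff hϖ]
  -- Puts the condition that is free of the residue first, as the counting lemma expects.
  simp only [and_comm]
  rw [ncard_residues_and_eq hϖ (by omega)]
  exact congrArg _ (mul_ite_zpow_eq card_residueField_ne_zero (by omega) (by omega))

theorem weight_mul_conv_sr_neg_psi_X (m k : ℤ) (n : ℕ) : weight (Nat.card 𝓀[F]) (.sr (-n : ℤ)) *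
    conv (ϖ : F) (uniformizer_ne_zero hϖ) (.sr (-n : ℤ)) ((psiOrbit (ϖ : F) m).indicator 1)
      (pointX (uniformizer_ne_zero hϖ) k) =
    0 := by
  rw [conv_sr_neg_eq_ncard hϖ (psiOrbit_isIwahoriInvariant hϖ m)]
  simp only [psiOrbit, Set.mem_ofPred_eq, valuation_act_upper_sr hϖ,
    (zpow_pos_of_irreducible hϖ _).ne, false_and, Set.ofPred_false, Set.ncard_empty,
    Nat.cast_zero, mul_zero]

theorem weight_mul_conv_r_phi_X (m k : ℤ) (n : ℕ) : weight (Nat.card 𝓀[F]) (.r (n : ℤ)) *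
    conv (ϖ : F) (uniformizer_ne_zero hϖ) (.r (n : ℤ)) ((phiOrbit (ϖ : F) m).indicator 1)
      (pointX (uniformizer_ne_zero hϖ) k) =
    0 := by
  rw [conv_r_eq_ncard hϖ (phiOrbit_isIwahoriInvariant hϖ m)]
  simp only [phiOrbit, Set.mem_ofPred_eq, valuation_act_upper_r hϖ,
    (zpow_pos_of_irreducible hϖ _).ne, and_false, Set.ofPred_false, Set.ncard_empty,
    Nat.cast_zero, mul_zero]

theorem weight_mul_conv_r_neg_phi_X (m k : ℤ) (n : ℕ) : weight (Nat.card 𝓀[F]) (.r (-n : ℤ)) *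
    conv (ϖ : F) (uniformizer_ne_zero hϖ) (.r (-n : ℤ)) ((phiOrbit (ϖ : F) m).indicator 1)
      (pointX (uniformizer_ne_zero hϖ) k) =
    if m - k ≤ n ∧ 1 - (m - k) ≤ n then (1 - (Nat.card 𝓀[F] : ℂ)⁻¹) * (Nat.card 𝓀[F] : ℂ) ^ (1 - (m - k) - n : ℤ)
      else 0 := by
  rw [conv_r_neg_eq_ncard hϖ (phiOrbit_isIwahoriInvariant hϖ m), weight_r_neg]
  simp only [phiOrbit, Set.mem_ofPred_eq, valuation_act_lower_r hϖ, zpow_le_zpow_iff hϖ]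
  rw [ncard_residues_and_eq hϖ (by omega)]
  exact mul_ite_zpow_eq card_residueField_ne_zero (by omega) (by omega)

theorem weight_mul_conv_sr_neg_phi_X (m k : ℤ) (n : ℕ) : weight (Nat.card 𝓀[F]) (.sr (-n : ℤ)) *
    conv (ϖ : F) (uniformizer_ne_zero hϖ) (.sr (-n : ℤ)) ((phiOrbit (ϖ : F) m).indicator 1)
      (pointX (uniformizer_ne_zero hϖ) k) =
    -if (n : ℤ) = k - m then (Nat.card 𝓀[F] : ℂ) ^ (0 : ℤ) else 0 := by
  rw [conv_sr_neg_eq_ncard hϖ (phiOrbit_isIwahoriInvariant hϖ m), weight_sr_neg, neg_mul]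
  simp only [phiOrbit, Set.mem_ofPred_eq, valuation_act_upper_sr hϖ, zpow_eq_zpow_iff hϖ,
    zero_le, true_and]
  rw [ncard_residues_const hϖ]
  exact congrArg _ (mul_ite_zpow_eq' card_residueField_ne_zero (by omega) (by omega))

theorem weight_mul_conv_sr_phi_X (m k : ℤ) (n : ℕ) : weight (Nat.card 𝓀[F]) (.sr (n + 1 : ℤ)) *
    conv (ϖ : F) (uniformizer_ne_zero hϖ) (.sr (n + 1 : ℤ)) ((phiOrbit (ϖ : F) m).indicator 1)
      (pointX (uniformizer_ne_zero hϖ) k) =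
    -if (n : ℤ) = m - k - 1 then (Nat.card 𝓀[F] : ℂ) ^ (-(2 * n + 1) : ℤ) else 0 := by
  rw [conv_sr_eq_ncard hϖ (phiOrbit_isIwahoriInvariant hϖ m), weight_sr, neg_mul]
  simp only [phiOrbit, Set.mem_ofPred_eq, valuation_act_lower_sr hϖ, zpow_eq_zpow_iff hϖ]
  simp only [and_comm]
  rw [ncard_residues_and_le hϖ (by omega)]
  exact congrArg _ (mul_ite_zpow_eq' card_residueField_ne_zero (by omega) (by omega))

theorem weight_mul_conv_r_psi_Y (m k : ℤ) (n : ℕ) : weight (Nat.card 𝓀[F]) (.r (n : ℤ)) *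
    conv (ϖ : F) (uniformizer_ne_zero hϖ) (.r (n : ℤ)) ((psiOrbit (ϖ : F) m).indicator 1)
      (pointY (uniformizer_ne_zero hϖ) k) =
    if -(m - k) ≤ n ∧ m - k + 1 ≤ n then (1 - (Nat.card 𝓀[F] : ℂ)⁻¹) * (Nat.card 𝓀[F] : ℂ) ^ (-(m - k) - n : ℤ)
      else 0 := by
  rw [conv_r_eq_ncard hϖ (psiOrbit_isIwahoriInvariant hϖ m), weight_r]
  simp only [psiOrbit, Set.mem_ofPred_eq, valuation_act_upper_r hϖ, zpow_le_zpow_iff hϖ]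
  simp only [and_comm]
  rw [ncard_residues_and_eq hϖ (by omega)]
  exact mul_ite_zpow_eq card_residueField_ne_zero (by omega) (by omega)

theorem weight_mul_conv_r_neg_psi_Y (m k : ℤ) (n : ℕ) : weight (Nat.card 𝓀[F]) (.r (-n : ℤ)) *
    conv (ϖ : F) (uniformizer_ne_zero hϖ) (.r (-n : ℤ)) ((psiOrbit (ϖ : F) m).indicator 1)
      (pointY (uniformizer_ne_zero hϖ) k) =
    0 := by
  rw [conv_r_neg_eq_ncard hϖ (psiOrbit_isIwahoriInvariant hϖ m)]
  simp only [psiOrbit, Set.mem_ofPred_eq, valuation_act_lower_r hϖ,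
    (zpow_pos_of_irreducible hϖ _).ne, false_and, Set.ofPred_false, Set.ncard_empty,
    Nat.cast_zero, mul_zero]

theorem weight_mul_conv_sr_neg_psi_Y (m k : ℤ) (n : ℕ) : weight (Nat.card 𝓀[F]) (.sr (-n : ℤ)) *
    conv (ϖ : F) (uniformizer_ne_zero hϖ) (.sr (-n : ℤ)) ((psiOrbit (ϖ : F) m).indicator 1)
      (pointY (uniformizer_ne_zero hϖ) k) =
    -if (n : ℤ) = m - k then (Nat.card 𝓀[F] : ℂ) ^ (-(2 * n + 1) : ℤ) else 0 := by
  rw [conv_sr_neg_eq_ncard hϖ (psiOrbit_isIwahoriInvariant hϖ m), weight_sr_neg, neg_mul]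
  simp only [psiOrbit, Set.mem_ofPred_eq, valuation_act_upper_sr hϖ, zpow_eq_zpow_iff hϖ]
  rw [ncard_residues_and_le hϖ (by omega)]
  exact congrArg _ (mul_ite_zpow_eq' card_residueField_ne_zero (by omega) (by omega))

theorem weight_mul_conv_sr_psi_Y (m k : ℤ) (n : ℕ) : weight (Nat.card 𝓀[F]) (.sr (n + 1 : ℤ)) *
    conv (ϖ : F) (uniformizer_ne_zero hϖ) (.sr (n + 1 : ℤ)) ((psiOrbit (ϖ : F) m).indicator 1)
      (pointY (uniformizer_ne_zero hϖ) k) =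
    -if (n : ℤ) = k - m - 1 then (Nat.card 𝓀[F] : ℂ) ^ (0 : ℤ) else 0 := by
  rw [conv_sr_eq_ncard hϖ (psiOrbit_isIwahoriInvariant hϖ m), weight_sr, neg_mul]
  simp only [psiOrbit, Set.mem_ofPred_eq, valuation_act_lower_sr hϖ, zpow_eq_zpow_iff hϖ,
    zero_le, and_true]
  rw [ncard_residues_const hϖ]
  exact congrArg _ (mul_ite_zpow_eq' card_residueField_ne_zero (by omega) (by omega))

theorem weight_mul_conv_r_phi_Y (m k : ℤ) (n : ℕ) : weight (Nat.card 𝓀[F]) (.r (n : ℤ)) *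
    conv (ϖ : F) (uniformizer_ne_zero hϖ) (.r (n : ℤ)) ((phiOrbit (ϖ : F) m).indicator 1)
      (pointY (uniformizer_ne_zero hϖ) k) =
    if (n : ℤ) = m - k then (Nat.card 𝓀[F] : ℂ) ^ (-(2 * n) : ℤ) else 0 := by
  rw [conv_r_eq_ncard hϖ (phiOrbit_isIwahoriInvariant hϖ m), weight_r]
  simp only [phiOrbit, Set.mem_ofPred_eq, valuation_act_upper_r hϖ, zpow_eq_zpow_iff hϖ]
  simp only [and_comm]
  rw [ncard_residues_and_le hϖ (by omega)]
  exact mul_ite_zpow_eq' card_residueField_ne_zero (by omega) (by omega)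

theorem weight_mul_conv_r_neg_phi_Y (m k : ℤ) (n : ℕ) : weight (Nat.card 𝓀[F]) (.r (-n : ℤ)) *
    conv (ϖ : F) (uniformizer_ne_zero hϖ) (.r (-n : ℤ)) ((phiOrbit (ϖ : F) m).indicator 1)
      (pointY (uniformizer_ne_zero hϖ) k) =
    if (n : ℤ) = k - m then (Nat.card 𝓀[F] : ℂ) ^ (0 : ℤ) else 0 := by
  rw [conv_r_neg_eq_ncard hϖ (phiOrbit_isIwahoriInvariant hϖ m), weight_r_neg]
  simp only [phiOrbit, Set.mem_ofPred_eq, valuation_act_lower_r hϖ, zpow_eq_zpow_iff hϖ,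
    zero_le, true_and]
  rw [ncard_residues_const hϖ]
  exact mul_ite_zpow_eq' card_residueField_ne_zero (by omega) (by omega)

theorem weight_mul_conv_sr_neg_phi_Y (m k : ℤ) (n : ℕ) : weight (Nat.card 𝓀[F]) (.sr (-n : ℤ)) *
    conv (ϖ : F) (uniformizer_ne_zero hϖ) (.sr (-n : ℤ)) ((phiOrbit (ϖ : F) m).indicator 1)
      (pointY (uniformizer_ne_zero hϖ) k) =
    -if (m - k).natAbs ≤ n then (1 - (Nat.card 𝓀[F] : ℂ)⁻¹) * (Nat.card 𝓀[F] : ℂ) ^ (-(m - k) - n : ℤ)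
      else 0 := by
  rw [conv_sr_neg_eq_ncard hϖ (phiOrbit_isIwahoriInvariant hϖ m), weight_sr_neg, neg_mul]
  simp only [phiOrbit, Set.mem_ofPred_eq, valuation_act_upper_sr hϖ, zpow_le_zpow_iff hϖ]
  rw [ncard_residues_and_eq hϖ (by omega)]
  exact congrArg _ (mul_ite_zpow_eq card_residueField_ne_zero (by omega) (by omega))

theorem weight_mul_conv_sr_phi_Y (m k : ℤ) (n : ℕ) : weight (Nat.card 𝓀[F]) (.sr (n + 1 : ℤ)) *
    conv (ϖ : F) (uniformizer_ne_zero hϖ) (.sr (n + 1 : ℤ)) ((phiOrbit (ϖ : F) m).indicator 1)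
      (pointY (uniformizer_ne_zero hϖ) k) =
    0 := by
  rw [conv_sr_eq_ncard hϖ (phiOrbit_isIwahoriInvariant hϖ m)]
  simp only [phiOrbit, Set.mem_ofPred_eq, valuation_act_lower_sr hϖ,
    (zpow_pos_of_irreducible hϖ _).ne, and_false, Set.ofPred_false, Set.ncard_empty,
    Nat.cast_zero, mul_zero]

end Evaluation

/-! ## Summation -/

theorem hasSum_of_single_of_ray {X : Type*} {f : X → ℂ} {S : ℂ} (x₀ : X) {ρ : ℕ → X}
    (hρ : Function.Injective ρ) (h0 : ∀ n, ρ n ≠ x₀) (hS : HasSum (fun n => f (ρ n)) S)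
    (hz : ∀ x, x ≠ x₀ → (∀ n, x ≠ ρ n) → f x = 0) : HasSum f (f x₀ + S) := by
  classical
  have h1 : HasSum (fun x => if x = x₀ then 0 else f x) S := by
    rw [← hρ.hasSum_iff]
    · convert hS using 2 with n
      exact if_neg (h0 n)
    · intro x hx
      split_ifs with hx0
      · rfl
      · exact hz x hx0 fun n hn => hx ⟨n, hn.symm⟩
  convert (hasSum_ite_eq x₀ (f x₀)).add h1 using 2 with x
  split_ifs with hx
  · rw [hx, add_zero]
  · rw [zero_add]

theorem hasSum_congr_fun {X : Type*} {f g : X → ℂ} {S : ℂ} (h : ∀ x, f x = g x) :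
    HasSum f S ↔ HasSum g S := by
  rw [funext h]

/-- The ray sums to `-ε q^k`, since `(1 - q⁻¹) ∑_n q^{k-n} = q^k`, and cancels the isolated term at
`w₀`. -/
theorem hasSum_zero_of_ray {f : W → ℂ} {q : ℕ} (hq : 1 < q) (w₀ : W) {ρ : ℕ → W}
    (hρ : Function.Injective ρ) (h0 : ∀ n, ρ n ≠ w₀) {k : ℤ} {ε : ℂ} (hw₀ : f w₀ = ε * (q : ℂ) ^ k)
    (hray : ∀ n : ℕ, f (ρ n) = -ε * ((1 - (q : ℂ)⁻¹) * (q : ℂ) ^ (k - n)))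
    (hz : ∀ w, w ≠ w₀ → (∀ n, w ≠ ρ n) → f w = 0) : HasSum f 0 := by
  have hq0 : (q : ℂ) ≠ 0 := by exact_mod_cast (zero_lt_one.trans hq).ne'
  have hq1 : ‖(q : ℂ)⁻¹‖ < 1 := by
    rw [norm_inv, Complex.norm_natCast]
    exact inv_lt_one_of_one_lt₀ (by exact_mod_cast hq)
  have hne : 1 - (q : ℂ)⁻¹ ≠ 0 := by
    intro h1
    rw [sub_eq_zero] at h1
    rw [← h1, norm_one] at hq1
    exact lt_irrefl _ hq1
  have hS : HasSum (fun n => f (ρ n)) (-(ε * (q : ℂ) ^ k)) := by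
    have h1 := (hasSum_geometric_of_norm_lt_one hq1).mul_left
      (-ε * ((1 - (q : ℂ)⁻¹) * (q : ℂ) ^ k))
    have h2 : -ε * ((1 - (q : ℂ)⁻¹) * (q : ℂ) ^ k) * (1 - (q : ℂ)⁻¹)⁻¹ = -(ε * (q : ℂ) ^ k) := by
      rw [mul_comm (1 - (q : ℂ)⁻¹), mul_assoc, mul_assoc, mul_inv_cancel₀ hne]
      ring
    rw [h2] at h1
    refine (hasSum_congr_fun fun n => ?_).mpr h1
    rw [hray, zpow_sub₀ hq0, zpow_natCast, inv_pow, div_eq_mul_inv]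
    ring
  have := hasSum_of_single_of_ray w₀ hρ h0 hS hz
  rwa [hw₀, add_neg_cancel] at this

theorem W_cases (w : W) : (∃ n : ℕ, w = .r (n : ℤ)) ∨ (∃ n : ℕ, w = .r (-n : ℤ)) ∨
    (∃ n : ℕ, w = .sr (-n : ℤ)) ∨ ∃ n : ℕ, w = .sr (n + 1 : ℤ) := by
  obtain ⟨i, n, rfl⟩ := exists_eq_elt w
  obtain ⟨m, rfl | rfl⟩ := n.even_or_odd' <;> fin_cases i
  · exact Or.inl ⟨m, elt_zero_even m⟩
  · exact Or.inr (Or.inl ⟨m, elt_one_even m⟩)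
  · exact Or.inr (Or.inr (Or.inl ⟨m, elt_zero_odd m⟩))
  · exact Or.inr (Or.inr (Or.inr ⟨m, elt_one_odd m⟩))

theorem r_injective {k l : ℤ} : (DihedralGroup.r k : W) = .r l ↔ k = l :=
  ⟨fun he => DihedralGroup.r.inj he, fun he => by rw [he]⟩

theorem sr_injective {k l : ℤ} : (DihedralGroup.sr k : W) = .sr l ↔ k = l :=
  ⟨fun he => DihedralGroup.sr.inj he, fun he => by rw [he]⟩

/-! ### Cancellation at the orbit representatives -/

section Vanishing

variable {F : Type*} [Field F] [ValuativeRel F] {ϖ : 𝒪[F]} (hϖ : Irreducible ϖ)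
  [TopologicalSpace F] [IsNonarchimedeanLocalField F]

theorem hasSum_weight_mul_conv_psi_X (m k : ℤ) : HasSum (fun w => weight (Nat.card 𝓀[F]) w *
    conv (ϖ : F) (uniformizer_ne_zero hϖ) w ((psiOrbit (ϖ : F) m).indicator 1)
      (pointX (uniformizer_ne_zero hϖ) k)) 0 := by
  refine hasSum_zero_of_ray (one_lt_card_residueField (F := F)) (.r (k - m))
    -- The ray starts where the count becomes nonempty, at `n = |m - k|`. The exponent is `0` for `m
    -- ≤ k` and `-2(m - k)` otherwise, so it matches the isolated term for translations of either
    -- sign.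
    (ρ := fun j => .sr (((m - k).natAbs + j : ℕ) + 1 : ℤ)) (k := -(m - k) - (m - k).natAbs) (ε := 1)
    (fun j j' hj => ?_) (fun j hj => ?_) ?_ (fun j => ?_) fun w hw hρ => ?_
  · have := sr_injective.mp hj
    omega
  · cases hj
  · rcases le_total m k with hmk | hmk
    · obtain ⟨n, hn⟩ := Int.eq_ofNat_of_zero_le (sub_nonneg.mpr hmk)
      rw [hn, weight_mul_conv_r_psi_X hϖ, if_pos hn.symm, one_mul]
      congr 1
      omega
    · obtain ⟨n, hn⟩ := Int.eq_ofNat_of_zero_le (sub_nonneg.mpr hmk)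
      rw [show k - m = -(n : ℤ) by omega, weight_mul_conv_r_neg_psi_X hϖ, if_pos hn.symm, one_mul]
      congr 1
      omega
  · rw [weight_mul_conv_sr_psi_X hϖ, if_pos (by omega), neg_mul, one_mul]
    congr 3
    omega
  · rcases W_cases w with ⟨n, rfl⟩ | ⟨n, rfl⟩ | ⟨n, rfl⟩ | ⟨n, rfl⟩
    · rw [weight_mul_conv_r_psi_X hϖ, if_neg]
      exact fun hn => hw (r_injective.mpr hn)
    · rw [weight_mul_conv_r_neg_psi_X hϖ, if_neg]
      exact fun hn => hw (r_injective.mpr (by omega))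
    · exact weight_mul_conv_sr_neg_psi_X hϖ m k n
    · rw [weight_mul_conv_sr_psi_X hϖ, if_neg, neg_zero]
      exact fun hn => hρ (n - (m - k).natAbs) (sr_injective.mpr (by omega))

theorem hasSum_weight_mul_conv_phi_X (m k : ℤ) : HasSum (fun w => weight (Nat.card 𝓀[F]) w *
    conv (ϖ : F) (uniformizer_ne_zero hϖ) w ((phiOrbit (ϖ : F) m).indicator 1)
      (pointX (uniformizer_ne_zero hϖ) k)) 0 := by
  refine hasSum_zero_of_ray (one_lt_card_residueField (F := F)) (.sr (m - k))
    -- The start is the least `n` satisfying both inequalities of the count. The exponent is `0` for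
    -- `m ≤ k` and `1 - 2(m - k)` for `m > k`, the value at the isolated reflection `sr (m - k)`,
    -- whose odd length gives `ε = -1`.
    (ρ := fun j => .r (-((max (m - k) (1 - (m - k))).toNat + j : ℕ) : ℤ))
    (k := 1 - (m - k) - max (m - k) (1 - (m - k))) (ε := -1)
    (fun j j' hj => ?_) (fun j hj => ?_) ?_ (fun j => ?_) fun w hw hρ => ?_
  · have := r_injective.mp hj
    omega
  · cases hj
  · rcases le_or_gt m k with hmk | hmk
    · obtain ⟨n, hn⟩ := Int.eq_ofNat_of_zero_le (sub_nonneg.mpr hmk)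
      rw [show m - k = -(n : ℤ) by omega, weight_mul_conv_sr_neg_phi_X hϖ, if_pos hn.symm, neg_mul,
        one_mul]
      congr 2
      omega
    · obtain ⟨n, hn⟩ := Int.eq_ofNat_of_zero_le (show 0 ≤ m - k - 1 by omega)
      rw [show m - k = (n : ℤ) + 1 by omega, weight_mul_conv_sr_phi_X hϖ, if_pos hn.symm, neg_mul,
        one_mul]
      congr 2
      omega
  · rw [weight_mul_conv_r_neg_phi_X hϖ, if_pos (by omega), neg_neg, one_mul]
    congr 2
    omega
  · rcases W_cases w with ⟨n, rfl⟩ | ⟨n, rfl⟩ | ⟨n, rfl⟩ | ⟨n, rfl⟩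
    · exact weight_mul_conv_r_phi_X hϖ m k n
    · rw [weight_mul_conv_r_neg_phi_X hϖ, if_neg]
      exact fun hn => hρ (n - (max (m - k) (1 - (m - k))).toNat) (r_injective.mpr (by omega))
    · rw [weight_mul_conv_sr_neg_phi_X hϖ, if_neg, neg_zero]
      exact fun hn => hw (sr_injective.mpr (by omega))
    · rw [weight_mul_conv_sr_phi_X hϖ, if_neg, neg_zero]
      exact fun hn => hw (sr_injective.mpr (by omega))

theorem hasSum_weight_mul_conv_psi_Y (m k : ℤ) : HasSum (fun w => weight (Nat.card 𝓀[F]) w *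
    conv (ϖ : F) (uniformizer_ne_zero hϖ) w ((psiOrbit (ϖ : F) m).indicator 1)
      (pointY (uniformizer_ne_zero hϖ) k)) 0 := by
  refine hasSum_zero_of_ray (one_lt_card_residueField (F := F)) (.sr (k - m))
    (ρ := fun j => .r (((max (-(m - k)) (m - k + 1)).toNat + j : ℕ) : ℤ))
    (k := -(m - k) - max (-(m - k)) (m - k + 1)) (ε := -1)
    (fun j j' hj => ?_) (fun j hj => ?_) ?_ (fun j => ?_) fun w hw hρ => ?_
  · have := r_injective.mp hj
    omega
  · cases hj
  · rcases le_or_gt k m with hmk | hmk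
    · obtain ⟨n, hn⟩ := Int.eq_ofNat_of_zero_le (sub_nonneg.mpr hmk)
      rw [show k - m = -(n : ℤ) by omega, weight_mul_conv_sr_neg_psi_Y hϖ, if_pos hn.symm, neg_mul,
        one_mul]
      congr 2
      omega
    · obtain ⟨n, hn⟩ := Int.eq_ofNat_of_zero_le (show 0 ≤ k - m - 1 by omega)
      rw [show k - m = (n : ℤ) + 1 by omega, weight_mul_conv_sr_psi_Y hϖ, if_pos hn.symm, neg_mul,
        one_mul]
      congr 2
      omega
  · rw [weight_mul_conv_r_psi_Y hϖ, if_pos (by omega), neg_neg, one_mul]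
    congr 2
    omega
  · rcases W_cases w with ⟨n, rfl⟩ | ⟨n, rfl⟩ | ⟨n, rfl⟩ | ⟨n, rfl⟩
    · rw [weight_mul_conv_r_psi_Y hϖ, if_neg]
      exact fun hn => hρ (n - (max (-(m - k)) (m - k + 1)).toNat) (r_injective.mpr (by omega))
    · exact weight_mul_conv_r_neg_psi_Y hϖ m k n
    · rw [weight_mul_conv_sr_neg_psi_Y hϖ, if_neg, neg_zero]
      exact fun hn => hw (sr_injective.mpr (by omega))
    · rw [weight_mul_conv_sr_psi_Y hϖ, if_neg, neg_zero]
      exact fun hn => hw (sr_injective.mpr (by omega))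

theorem hasSum_weight_mul_conv_phi_Y (m k : ℤ) : HasSum (fun w => weight (Nat.card 𝓀[F]) w *
    conv (ϖ : F) (uniformizer_ne_zero hϖ) w ((phiOrbit (ϖ : F) m).indicator 1)
      (pointY (uniformizer_ne_zero hϖ) k)) 0 := by
  refine hasSum_zero_of_ray (one_lt_card_residueField (F := F)) (.r (m - k))
    (ρ := fun j => .sr (-((m - k).natAbs + j : ℕ) : ℤ)) (k := -(m - k) - (m - k).natAbs) (ε := 1)
    (fun j j' hj => ?_) (fun j hj => ?_) ?_ (fun j => ?_) fun w hw hρ => ?_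
  · have := sr_injective.mp hj
    omega
  · cases hj
  · rcases le_total k m with hmk | hmk
    · obtain ⟨n, hn⟩ := Int.eq_ofNat_of_zero_le (sub_nonneg.mpr hmk)
      rw [hn, weight_mul_conv_r_phi_Y hϖ, if_pos hn.symm, one_mul]
      congr 1
      omega
    · obtain ⟨n, hn⟩ := Int.eq_ofNat_of_zero_le (sub_nonneg.mpr hmk)
      rw [show m - k = -(n : ℤ) by omega, weight_mul_conv_r_neg_phi_Y hϖ, if_pos hn.symm, one_mul]
      congr 1
      omega
  · rw [weight_mul_conv_sr_neg_phi_Y hϖ, if_pos (by omega), neg_mul, one_mul]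
    congr 3
    omega
  · rcases W_cases w with ⟨n, rfl⟩ | ⟨n, rfl⟩ | ⟨n, rfl⟩ | ⟨n, rfl⟩
    · rw [weight_mul_conv_r_phi_Y hϖ, if_neg]
      exact fun hn => hw (r_injective.mpr hn)
    · rw [weight_mul_conv_r_neg_phi_Y hϖ, if_neg]
      exact fun hn => hw (r_injective.mpr (by omega))
    · rw [weight_mul_conv_sr_neg_phi_Y hϖ, if_neg, neg_zero]
      exact fun hn => hρ (n - (m - k).natAbs) (sr_injective.mpr (by omega))
    · exact weight_mul_conv_sr_phi_Y hϖ m k n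

/-- Both sides are constant on `I`-orbits, so the two families of representatives suffice; the
constant `c` will be the specialized scalar factor. -/
theorem actsTo_of_points {S : Set (Plane F)} (hS : IsIwahoriInvariant S) (c : ℂ)
    (hX : ∀ k, HasSum (fun w => weight (Nat.card 𝓀[F]) w *
      conv (ϖ : F) (uniformizer_ne_zero hϖ) w (S.indicator 1)
        (pointX (uniformizer_ne_zero hϖ) k)) 0)
    (hY : ∀ k, HasSum (fun w => weight (Nat.card 𝓀[F]) w *
      conv (ϖ : F) (uniformizer_ne_zero hϖ) w (S.indicator 1)
        (pointY (uniformizer_ne_zero hϖ) k)) 0) :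
    ActsTo (ϖ : F) (uniformizer_ne_zero hϖ) (fun w => c * weight (Nat.card 𝓀[F]) w)
      (S.indicator 1) 0 := by
  intro x
  obtain ⟨i, hi, k, rfl | rfl⟩ := exists_eq_act_point hϖ x
  · simpa only [conv_act hS _ hi, mul_assoc, mul_zero, Pi.zero_apply] using (hX k).mul_left c
  · simpa only [conv_act hS _ hi, mul_assoc, mul_zero, Pi.zero_apply] using (hY k).mul_left c

end Vanishing

/-! ## Specialization -/

/-- Only even powers of `X = q^{-1/2}` occur, so the series is `1 + 2 ∑_{j>0} (-q⁻¹)^j`, which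
converges because `q > 1`. -/
theorem specializes_kappa {q : ℕ} (hq : 1 < q) :
    Specializes q kappa ((1 - (q : ℂ)⁻¹) / (1 + (q : ℂ)⁻¹)) := by
  have hq0 : (q : ℂ) ≠ 0 := by exact_mod_cast (zero_lt_one.trans hq).ne'
  have hq1 : ‖-(q : ℂ)⁻¹‖ < 1 := by
    rw [norm_neg, norm_inv, Complex.norm_natCast]
    exact inv_lt_one_of_one_lt₀ (by exact_mod_cast hq)
  have hne : 1 + (q : ℂ)⁻¹ ≠ 0 := by
    intro h1
    rw [← eq_neg_iff_add_eq_zero] at h1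
    rw [← h1, norm_one] at hq1
    exact lt_irrefl _ hq1
  have hsq : ((Real.sqrt q : ℝ) : ℂ) ^ 2 = q := by
    rw [← Complex.ofReal_pow, Real.sq_sqrt q.cast_nonneg, Complex.ofReal_natCast]
  have hS : HasSum (fun j : ℕ => ((kappa.coeff (2 * (j + 1 : ℕ)) : ℤ) : ℂ) *
      ((Real.sqrt q : ℝ) : ℂ) ^ (-(2 * (j + 1 : ℕ) : ℤ)))
      (2 * -(q : ℂ)⁻¹ * (1 - -(q : ℂ)⁻¹)⁻¹) := by
    refine (hasSum_congr_fun fun j => ?_).mpr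
      ((hasSum_geometric_of_norm_lt_one hq1).mul_left (2 * -(q : ℂ)⁻¹))
    rw [kappa_coeff, kappaCoeff_two_mul_succ, zpow_neg, zpow_mul, zpow_ofNat, hsq, zpow_natCast]
    push_cast
    rw [neg_pow (q : ℂ)⁻¹, pow_succ, pow_succ, inv_pow, mul_inv]
    ring
  have := hasSum_of_single_of_ray (f := fun n : ℤ => ((kappa.coeff n : ℤ) : ℂ) *
    ((Real.sqrt q : ℝ) : ℂ) ^ (-n)) 0 (ρ := fun j => 2 * (j + 1 : ℕ)) (fun j j' hj => by
      have : (2 * (j + 1 : ℕ) : ℤ) = 2 * (j' + 1 : ℕ) := hj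
      omega) (fun j => by omega) hS (fun n hn hρ => by
        rw [kappa_coeff, kappaCoeff, if_neg hn, if_neg, Int.cast_zero, zero_mul]
        exact fun hn' => hρ ((n / 2).toNat - 1) (by omega))
  have h1 : ((kappa.coeff 0 : ℤ) : ℂ) * ((Real.sqrt q : ℝ) : ℂ) ^ (-(0 : ℤ)) +
      2 * -(q : ℂ)⁻¹ * (1 - -(q : ℂ)⁻¹)⁻¹ = (1 - (q : ℂ)⁻¹) / (1 + (q : ℂ)⁻¹) := by
    rw [kappa_coeff, show kappaCoeff 0 = 1 from if_pos rfl, neg_zero, zpow_zero, Int.cast_one,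
      mul_one, sub_neg_eq_add, eq_div_iff hne, add_mul, mul_assoc, inv_mul_cancel₀ hne]
    ring
  exact h1 ▸ this

theorem specializes_kappa_mul_g {q : ℕ} (hq : 1 < q) (w : W) :
    Specializes q (kappa * g w) ((1 - (q : ℂ)⁻¹) / (1 + (q : ℂ)⁻¹) * weight q w) := by
  have hsq : ((Real.sqrt q : ℝ) : ℂ) ^ 2 = q := by
    rw [← Complex.ofReal_pow, Real.sq_sqrt q.cast_nonneg, Complex.ofReal_natCast]
  have hs0 : ((Real.sqrt q : ℝ) : ℂ) ≠ 0 := by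
    have : q ≠ 0 := by omega
    rw [Complex.ofReal_ne_zero, Real.sqrt_ne_zero']
    positivity
  -- The factor `g w` is a signed monomial of degree `2 ℓ(w)`; reindexing by this shift reduces to
  -- the series of `kappa`.
  rw [Specializes, ← (Equiv.addRight (2 * length w : ℤ)).hasSum_iff]
  refine (hasSum_congr_fun fun n => ?_).mpr ((specializes_kappa hq).mul_right (weight q w))
  simp only [Function.comp_apply, Equiv.coe_addRight, kappa_mul_g_coeff, add_sub_cancel_right,
    kappa_coeff, weight]
  rw [neg_add, zpow_add₀ hs0, neg_mul_eq_mul_neg, zpow_mul, zpow_ofNat, hsq]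
  push_cast
  ring

end AffineSL2

end

/-! ### The expansion of `t_1` and its action on the orbit functions -/

theorem propositiont1 {F : Type*} [Field F] [ValuativeRel F] [TopologicalSpace F]
    [IsNonarchimedeanLocalField F] (ϖ : 𝒪[F]) (hϖ : Irreducible ϖ) :
    ∃ t : AffineSL2.W → ℤ⸨X⸩,
      (∀ t', AffineSL2.IsAsympElement 1 t' ↔ t' = t) ∧
      (∃ κ : ℤ⸨X⸩, κ * (1 + HahnSeries.single 2 1) = 1 - HahnSeries.single 2 1 ∧
        ∀ w, t w = κ * AffineSL2.g w) ∧
      ∃ τ : AffineSL2.W → ℂ,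
        (∀ w, AffineSL2.Specializes (Nat.card 𝓀[F]) (t w) (τ w)) ∧
        ∀ m : ℤ,
          AffineSL2.ActsTo (ϖ : F) (AffineSL2.uniformizer_ne_zero hϖ) τ (AffineSL2.psi (ϖ : F) m) 0 ∧
          AffineSL2.ActsTo (ϖ : F) (AffineSL2.uniformizer_ne_zero hϖ) τ (AffineSL2.phi (ϖ : F) m) 0 := by
  refine ⟨fun w => AffineSL2.kappa * AffineSL2.g w, fun t' => AffineSL2.isAsympElement_one_iff t',
    ⟨AffineSL2.kappa, AffineSL2.kappa_mul, fun _ => rfl⟩, _, fun w =>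
      AffineSL2.specializes_kappa_mul_g (AffineSL2.one_lt_card_residueField (F := F)) w,
    fun m => ⟨?_, ?_⟩⟩
  · exact AffineSL2.actsTo_of_points hϖ (AffineSL2.psiOrbit_isIwahoriInvariant hϖ m) _
      (AffineSL2.hasSum_weight_mul_conv_psi_X hϖ m) (AffineSL2.hasSum_weight_mul_conv_psi_Y hϖ m)
  · exact AffineSL2.actsTo_of_points hϖ (AffineSL2.phiOrbit_isIwahoriInvariant hϖ m) _
      (AffineSL2.hasSum_weight_mul_conv_phi_X hϖ m) (AffineSL2.hasSum_weight_mul_conv_phi_Y hϖ m)
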